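/- Let $d\ge 1$ and let $f:\mathbb R^d\to\mathbb R$ be differentiable with $L$-Lipschitz gradient (Euclidean norm). Assume that $f$ is bounded below, put $f^\star=\inf f$, and assume the Polyak–Łojasiewicz condition: for some $\mu>0$, $$\tfrac12\|\nabla f(x)\|^2\ \ge\ \mu\,(f(x)-f^\star)\qquad\text{for all }x\in\mathbb R^d.$$ Assume that $f$ has exactly one stationary point $x^\star$. Let $p>1$, $A>0$, $B\ge 0$, $\alpha>0$, $K>0$, $\xi\in\mathbb R$, and put $\alpha_k=\alpha(k+K)^{-\xi}$ for $k\ge 0$. An admissible SGD run consists of random vectors $x_0,x_1,\dots$ and $w_0,w_1,\dots$ in $\mathbb R^d$ on a common probability space (with $x_0$ arbitrary) such that $$x_{k+1}=x_k+\alpha_k\bigl(-\nabla f(x_k)+w_k\bigr)\qquad (k\ge 0),$$ and, with $\mathcal F_k=\sigma(x_0,\dots,x_k)$, for every $k\ge0$ the noise $w_k$ is integrable and, almost surely, $$\mathbb E[w_k\mid\mathcal F_k]=0,\qquad \mathbb E\bigl[\|w_k\|^p\mid\mathcal F_k\bigr]\le A+B\,\|x_k-x^\star\|^p .$$ Then: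 (i) The function $\Phi(z)=f(x^\star+z)-f^\star$, so that $\Phi(x-x^\star)=f(x)-f^\star$, is a Lyapunov function for $H(x)=x-\nabla f(x)$ at $x^\star$. That is, $\Phi$ is nonnegative and differentiable, and there are constants $\eta,c_1,c_2,L_2>0$ such that for all $x,y\in\mathbb R^d$, $$\langle\nabla\Phi(x-x^\star),H(x)-x\rangle\le-\eta\,\Phi(x-x^\star),$$ $$\Phi(y)\le\Phi(x)+\langle\nabla\Phi(x),y-x\rangle+\tfrac{L_2}{2}\|y-x\|^2,$$ $$c_1\|x-x^\star\|^2\le\Phi(x-x^\star)\le c_2\|x-x^\star\|^2 .$$ (ii) Every admissible SGD run satisfies $x_k\to x^\star$ almost surely if and only if $\xi\in(1/p,1]$. -/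

import Mathlib

open MeasureTheory ProbabilityTheory Filter Topology
open scoped ENNReal NNReal

universe u

/-- `f : ℝ^d → ℝ` is `L`-smooth: differentiable everywhere, with `L`-Lipschitz gradient
(Euclidean norm). -/
def IsSmoothWith {d : ℕ} (L : ℝ≥0) (f : EuclideanSpace ℝ (Fin d) → ℝ) : Prop :=
  Differentiable ℝ f ∧ LipschitzWith L (gradient f)

/-- The Polyak–Łojasiewicz condition, where `fstar` is the infimum of `f`
(`IsGLB` says that `f` is bounded below and that `fstar` is its greatest lower bound). -/
def SatisfiesPL {d : ℕ} (f : EuclideanSpace ℝ (Fin d) → ℝ) (fstar : ℝ) : Prop :=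
  IsGLB (Set.range f) fstar ∧
    ∃ μ : ℝ, 0 < μ ∧ ∀ x, μ * (f x - fstar) ≤ ‖gradient f x‖ ^ 2 / 2

/-- `Φ` is a Lyapunov function for the operator `H` and the point `xstar`: it is nonnegative and
differentiable, has negative drift along `H x - x`, is smooth, and grows quadratically. -/
def IsLyapunovFunction {d : ℕ}
    (H : EuclideanSpace ℝ (Fin d) → EuclideanSpace ℝ (Fin d))
    (xstar : EuclideanSpace ℝ (Fin d)) (Φ : EuclideanSpace ℝ (Fin d) → ℝ) : Prop :=
  (∀ z, 0 ≤ Φ z) ∧ Differentiable ℝ Φ ∧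
    ∃ η c₁ c₂ L₂ : ℝ, 0 < η ∧ 0 < c₁ ∧ 0 < c₂ ∧ 0 < L₂ ∧
      (∀ x, inner ℝ (gradient Φ (x - xstar)) (H x - x) ≤ -η * Φ (x - xstar)) ∧
      (∀ x y, Φ y ≤ Φ x + inner ℝ (gradient Φ x) (y - x) + L₂ / 2 * ‖y - x‖ ^ 2) ∧
      (∀ x, c₁ * ‖x - xstar‖ ^ 2 ≤ Φ (x - xstar) ∧ Φ (x - xstar) ≤ c₂ * ‖x - xstar‖ ^ 2)

/-- The step sizes `α_k = α (k + K)^{-ξ}`. -/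
noncomputable def stepSize (α K ξ : ℝ) (k : ℕ) : ℝ := α * ((k : ℝ) + K) ^ (-ξ)

/-- The σ-algebra `F_k = σ(x_0, …, x_k)` generated by the first `k + 1` iterates. -/
abbrev iterateHistory {Ω : Type u} {d : ℕ} (x : ℕ → Ω → EuclideanSpace ℝ (Fin d)) (k : ℕ) :
    MeasurableSpace Ω :=
  ⨆ j ≤ k, MeasurableSpace.comap (x j) inferInstance

/-- The stochastic processes `x` (iterates) and `w` (noise) form a run of SGD on `f` with step sizes
`a` : `x_{k+1} = x_k + a_k (-∇f(x_k) + w_k)`, with an arbitrary random initial point `x_0`. -/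
structure IsSGD {Ω : Type u} [MeasurableSpace Ω] {d : ℕ}
    (f : EuclideanSpace ℝ (Fin d) → ℝ) (a : ℕ → ℝ)
    (x w : ℕ → Ω → EuclideanSpace ℝ (Fin d)) : Prop where
  measurable_iterate : ∀ k, Measurable (x k)
  measurable_noise : ∀ k, Measurable (w k)
  step : ∀ k ω, x (k + 1) ω = x k ω + a k • (-gradient f (x k ω) + w k ω)

/-- Unbiased noise: `w_k` is integrable and `E[w_k | F_k] = 0` almost surely. -/
def IsUnbiasedNoise {Ω : Type u} [MeasurableSpace Ω] {d : ℕ} (P : Measure Ω)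
    (x w : ℕ → Ω → EuclideanSpace ℝ (Fin d)) : Prop :=
  ∀ k, Integrable (w k) P ∧ P[w k | iterateHistory x k] =ᵐ[P] 0

/-- The `p`-th moment noise condition `E[‖w_k‖^p | F_k] ≤ A + B ‖x_k - xstar‖^p` almost surely,
with the conditional expectation of a `[0,∞]`-valued random variable. -/
def HasMomentBound {Ω : Type u} [MeasurableSpace Ω] {d : ℕ} (P : Measure Ω) (p A B : ℝ)
    (xstar : EuclideanSpace ℝ (Fin d)) (x w : ℕ → Ω → EuclideanSpace ℝ (Fin d)) : Prop :=
  ∀ k, P⁻[fun ω => ‖w k ω‖ₑ ^ p | iterateHistory x k] ≤ᵐ[P]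
    fun ω => ENNReal.ofReal (A + B * ‖x k ω - xstar‖ ^ p)

/-! Geometry: gradient descent with a small fixed step contracts `f - fstar` geometrically, by the
PL inequality, so its orbits have finite length and end at the only stationary point. That point is
therefore the minimizer, and the length of the orbit gives `c * ‖x - xstar‖ ^ 2 ≤ f x - fstar`. With
the descent lemma this is the Lyapunov property.

Sufficiency of `1 / p < ξ ≤ 1`: here `∑ a_k` diverges and `∑ a_k ^ p` converges. The event `a_k
‖w_k‖ > 1 + ‖x_k - xstar‖` has probability `O(a_k ^ p)`, so by Borel–Cantelli it occurs finitely
often (`measure_lt_mul_norm_le`). Between such events the Lyapunov function is `(f - fstar) ^ (k +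
2)` with `k + 2 ≥ p`. Truncation bounds all terms of order two and higher by the `p`-th moment,
which covers `p < 2`. The high power covers `p > 2`, where `∑ a_k ^ 2` may diverge: by Young's
inequality the variance term is absorbed into the drift up to `O(a_k ^ p)`. The result is `E[V'] ≤
(1 - μ a_k / 2) V + C a_k ^ p` (`exists_setIntegral_step_le`), and supermartingale convergence
together with vanishing means gives `V → 0` (`ae_tendsto_zero_of_setIntegral_le`). As `x_0` need not
be integrable, everything is integrated over events of the past on which the iterate is bounded.

Necessity: runs started at `xstar` with independent symmetric noise along one unit vector give
counterexamples. For `ξ < 0`, noise of constant size moves every iterate by a fixed amount. For `0 ≤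
ξ ≤ 1 / p`, noise of size `1 / a_k` with probability `min 1 (A a_k ^ p)` causes unit jumps
infinitely often. For `ξ > 1`, the total remaining step length is finite and cannot undo one kick.
-/

/-! ### Descent lemma and quadratic growth from the PL inequality. -/

section Smooth

variable {E : Type*} [NormedAddCommGroup E] [InnerProductSpace ℝ E] [CompleteSpace E]

/-- The descent lemma for a function with Lipschitz gradient. -/
theorem le_add_inner_gradient_add_sq {f : E → ℝ} {ℓ : ℝ≥0} (hf : Differentiable ℝ f)
    (hg : LipschitzWith ℓ (gradient f)) (x y : E) :
    f y ≤ f x + inner ℝ (gradient f x) (y - x) + ℓ / 2 * ‖y - x‖ ^ 2 := by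
  set v := y - x with hv
  have hder : ∀ t : ℝ, HasDerivAt (fun t : ℝ => f (x + t • v))
      (inner ℝ (gradient f (x + t • v)) v) t := by
    intro t
    have h1 : HasDerivAt (fun t : ℝ => x + t • v) v t := by
      simpa using ((hasDerivAt_id t).smul_const v).const_add x
    have h2 := (hf (x + t • v)).hasFDerivAt.comp_hasDerivAt t h1
    rwa [← inner_gradient_left (𝕜 := ℝ)] at h2
  have hB : ∀ t : ℝ, HasDerivAt
      (fun t : ℝ => f x + t * inner ℝ (gradient f x) v + ℓ / 2 * ‖v‖ ^ 2 * t ^ 2)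
      (inner ℝ (gradient f x) v + ℓ * ‖v‖ ^ 2 * t) t := by
    intro t
    have h1 := (((hasDerivAt_id t).mul_const (inner ℝ (gradient f x) v)).const_add (f x)).add
      ((hasDerivAt_pow 2 t).const_mul (ℓ / 2 * ‖v‖ ^ 2 : ℝ))
    refine h1.congr_deriv ?_
    simp
    ring
  have key := image_le_of_deriv_right_le_deriv_boundary (a := 0) (b := 1)
    (f := fun t : ℝ => f (x + t • v))
    (B := fun t : ℝ => f x + t * inner ℝ (gradient f x) v + ℓ / 2 * ‖v‖ ^ 2 * t ^ 2)
    (fun t _ => (hder t).continuousAt.continuousWithinAt)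
    (fun t _ => (hder t).hasDerivWithinAt) (by simp)
    (fun t _ => (hB t).continuousAt.continuousWithinAt)
    (fun t _ => (hB t).hasDerivWithinAt) (fun t ht => ?_)
  · have := key (x := 1) (by simp)
    simp only [one_smul, hv, add_sub_cancel] at this
    simpa [hv] using this
  · have h1 : inner ℝ (gradient f (x + t • v)) v - inner ℝ (gradient f x) v
        ≤ ℓ * ‖v‖ ^ 2 * t := by
      rw [← inner_sub_left]
      refine (real_inner_le_norm _ _).trans ?_
      have h2 := hg.dist_le_mul (x + t • v) x
      rw [dist_eq_norm, dist_eq_norm, add_sub_cancel_left, norm_smul, Real.norm_eq_abs,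
        abs_of_nonneg ht.1] at h2
      calc _ ≤ ℓ * (t * ‖v‖) * ‖v‖ := by gcongr
        _ = _ := by ring
    linarith

/-- For a smooth function satisfying the Polyak–Łojasiewicz inequality with a single stationary
point, the stationary point is the minimizer and the function grows quadratically around it. -/
theorem exists_quadratic_growth {f : E → ℝ} {ℓ : ℝ≥0} (hf : Differentiable ℝ f)
    (hg : LipschitzWith ℓ (gradient f)) {fstar μ : ℝ} (hlb : ∀ x, fstar ≤ f x) (hμ : 0 < μ)
    (hPL : ∀ x, μ * (f x - fstar) ≤ ‖gradient f x‖ ^ 2 / 2) {xstar : E}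
    (hx : ∀ x, gradient f x = 0 → x = xstar) :
    f xstar = fstar ∧ ∃ c : ℝ, 0 < c ∧ ∀ x, c * ‖x - xstar‖ ^ 2 ≤ f x - fstar := by
  -- The step of gradient descent is `1 / b`: `ℓ ≤ b` makes each step a descent, `2 * μ ≤ b` keeps
  -- the contraction factor `1 - μ / b` nonnegative, and `b > 0` is needed because `ℓ` may vanish.
  obtain ⟨b, hℓb, hμb, hb⟩ : ∃ b : ℝ, ℓ ≤ b ∧ 2 * μ ≤ b ∧ 0 < b :=
    ⟨ℓ + 2 * μ, by linarith, by linarith [ℓ.coe_nonneg], by positivity⟩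
  set T : E → E := fun x => x - b⁻¹ • gradient f x with hT
  have hTc : Continuous T := continuous_id.sub (hg.continuous.const_smul _)
  have hdesc : ∀ x, f (T x) ≤ f x - ‖gradient f x‖ ^ 2 / (2 * b) := by
    intro x
    have h := le_add_inner_gradient_add_sq hf hg x (T x)
    have e : T x - x = -(b⁻¹ • gradient f x) := by simp [hT]
    rw [e, inner_neg_right, real_inner_smul_right, real_inner_self_eq_norm_sq, norm_neg, norm_smul,
      Real.norm_eq_abs, abs_of_pos (inv_pos.2 hb)] at h
    have h2 : (ℓ : ℝ) / 2 * (b⁻¹ * ‖gradient f x‖) ^ 2 ≤ b / 2 * (b⁻¹ * ‖gradient f x‖) ^ 2 := by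
      gcongr
    have h3 : b / 2 * (b⁻¹ * ‖gradient f x‖) ^ 2 = ‖gradient f x‖ ^ 2 / (2 * b) := by
      field_simp
    have h4 : b⁻¹ * ‖gradient f x‖ ^ 2 = 2 * (‖gradient f x‖ ^ 2 / (2 * b)) := by
      field_simp
    linarith
  set ρ := 1 - μ / b with hρ
  have hμb' : μ / b ≤ 1 / 2 := by rw [div_le_iff₀ hb]; linarith
  have hμb0 : 0 < μ / b := by positivity
  have hρ0 : 0 ≤ ρ := by linarith
  have hρ1 : ρ < 1 := by linarith
  have hcontr : ∀ x, f (T x) - fstar ≤ ρ * (f x - fstar) := by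
    intro x
    have h1 := hdesc x
    have h2 : μ / b * (f x - fstar) ≤ ‖gradient f x‖ ^ 2 / (2 * b) := by
      have := div_le_div_of_nonneg_right (hPL x) hb.le
      calc _ = μ * (f x - fstar) / b := by ring
        _ ≤ _ := this
        _ = _ := by ring
    rw [hρ]; linarith
  have hiter : ∀ x n, f (T^[n] x) - fstar ≤ ρ ^ n * (f x - fstar) := by
    intro x n
    induction n with
    | zero => simp
    | succ n ih =>
      rw [Function.iterate_succ_apply', pow_succ']
      refine (hcontr _).trans ?_
      rw [mul_assoc]
      gcongr
  -- The squared step length is paid for by the decrease of `f`, which is at most `f x - fstar`.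
  have hstep : ∀ x, dist x (T x) ≤ √(2 / b * (f x - fstar)) := by
    intro x
    have h1 := hdesc x
    have h2 := hlb (T x)
    apply Real.le_sqrt_of_sq_le
    rw [dist_eq_norm]
    have e : x - T x = b⁻¹ • gradient f x := by simp [hT]
    rw [e, norm_smul, Real.norm_eq_abs, abs_of_pos (inv_pos.2 hb)]
    calc _ = 2 / b * (‖gradient f x‖ ^ 2 / (2 * b)) := by field_simp
      _ ≤ _ := by gcongr; linarith
  set r := √ρ with hr
  have hr1 : r < 1 := by rw [hr, Real.sqrt_lt' one_pos]; simpa using hρ1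
  have hgeom : ∀ x n, dist (T^[n] x) (T^[n + 1] x) ≤ √(2 / b * (f x - fstar)) * r ^ n := by
    intro x n
    rw [Function.iterate_succ_apply']
    refine (hstep _).trans ?_
    apply Real.sqrt_le_iff.2
    refine ⟨by positivity, ?_⟩
    have h0 : 0 ≤ f x - fstar := sub_nonneg.2 (hlb x)
    rw [mul_pow, Real.sq_sqrt (by positivity), ← pow_mul, mul_comm n 2, pow_mul,
      Real.sq_sqrt hρ0, mul_assoc, mul_comm (f x - fstar)]
    gcongr
    exact hiter x n
  -- A Cauchy orbit converges to a fixed point of `T`, that is, to a stationary point, and there is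
  -- only one.
  have hlim : ∀ x, Tendsto (fun n => T^[n] x) atTop (𝓝 xstar) := by
    intro x
    obtain ⟨y, hy⟩ := cauchySeq_tendsto_of_complete
      (cauchySeq_of_le_geometric r _ hr1 (hgeom x))
    have h1 : Tendsto (fun n => T^[n + 1] x) atTop (𝓝 (T y)) := by
      simp only [Function.iterate_succ_apply']
      exact (hTc.tendsto y).comp hy
    have h2 : T y = y := tendsto_nhds_unique h1 ((tendsto_add_atTop_iff_nat 1).2 hy)
    have h3 : gradient f y = 0 := by simpa [hT, hb.ne'] using h2
    rwa [← hx y h3]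
  refine ⟨?_, (1 - r) ^ 2 * b / 2, ?_, ?_⟩
  · have h1 : Tendsto (fun n => f (T^[n] xstar) - fstar) atTop (𝓝 (f xstar - fstar)) :=
      ((hf.continuous.tendsto _).comp (hlim xstar)).sub_const _
    have h2 : Tendsto (fun n => ρ ^ n * (f xstar - fstar)) atTop (𝓝 0) := by
      simpa using (tendsto_pow_atTop_nhds_zero_of_lt_one hρ0 hρ1).mul_const (f xstar - fstar)
    have := le_of_tendsto_of_tendsto' h1 h2 (hiter xstar)
    linarith [hlb xstar]
  · have : 0 < 1 - r := by linarith
    positivity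
  · intro x
    have h0 : 0 ≤ f x - fstar := sub_nonneg.2 (hlb x)
    have h1 := dist_le_of_le_geometric_of_tendsto₀ r _ hr1 (hgeom x) (hlim x)
    have hr' : 0 < 1 - r := by linarith
    rw [Function.iterate_zero, id, le_div_iff₀ hr', dist_eq_norm] at h1
    have h2 : (‖x - xstar‖ * (1 - r)) ^ 2 ≤ 2 / b * (f x - fstar) := by
      rw [← Real.sq_sqrt (show 0 ≤ 2 / b * (f x - fstar) by positivity)]
      gcongr
    calc _ = b / 2 * (‖x - xstar‖ * (1 - r)) ^ 2 := by ring
      _ ≤ b / 2 * (2 / b * (f x - fstar)) := by gcongr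
      _ = _ := by field_simp

end Smooth

/-! ### The Lyapunov property of `f - fstar`. -/

section Lyapunov

variable {d : ℕ}

theorem gradient_const_add_sub {f : EuclideanSpace ℝ (Fin d) → ℝ} (hf : Differentiable ℝ f)
    (a z : EuclideanSpace ℝ (Fin d)) (c : ℝ) :
    gradient (fun z => f (a + z) - c) z = gradient f (a + z) := by
  apply HasGradientAt.gradient
  rw [hasGradientAt_iff_hasFDerivAt]
  have h := (hf (a + z)).hasGradientAt.hasFDerivAt
  have h2 : HasFDerivAt (fun z => f (a + z)) _ z := h.comp z ((hasFDerivAt_id z).const_add a)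
  exact h2.sub_const c

/-- The drift is `-‖∇f‖ ^ 2`, so PL gives `η = 2 * μ`; the lower quadratic bound is the growth
lemma, the upper one the descent lemma at `xstar`. The constant `L + 1` replaces `L` because `L = 0`
is allowed and `L₂` must be positive. -/
theorem isLyapunovFunction_of_isSmoothWith {f : EuclideanSpace ℝ (Fin d) → ℝ} {L : ℝ≥0}
    (hsmooth : IsSmoothWith L f) {fstar : ℝ} (hPL : SatisfiesPL f fstar)
    {xstar : EuclideanSpace ℝ (Fin d)} (hxstar : ∀ x, gradient f x = 0 ↔ x = xstar) :
    IsLyapunovFunction (fun x => x - gradient f x) xstar (fun z => f (xstar + z) - fstar) := by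
  obtain ⟨hf, hg⟩ := hsmooth
  obtain ⟨hglb, μ, hμ, hPL⟩ := hPL
  have hlb : ∀ x, fstar ≤ f x := fun x => hglb.1 ⟨x, rfl⟩
  obtain ⟨hmin, c, hc, hgrow⟩ := exists_quadratic_growth hf hg hlb hμ hPL fun x => (hxstar x).1
  have hdesc := le_add_inner_gradient_add_sq hf (hg.weaken (le_add_of_nonneg_right zero_le_one))
  have hL : 0 < ((L + 1 : ℝ≥0) : ℝ) := by positivity
  refine ⟨fun z => sub_nonneg.2 (hlb _), ?_, 2 * μ, c, (L + 1 : ℝ≥0) / 2, (L + 1 : ℝ≥0),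
    by positivity, hc, by positivity, hL, fun x => ?_, fun x y => ?_, fun x => ?_⟩
  · exact (hf.comp (differentiable_id.const_add xstar)).sub_const fstar
  · rw [gradient_const_add_sub hf]
    simp only [add_sub_cancel, sub_sub_cancel_left, inner_neg_right, real_inner_self_eq_norm_sq]
    linarith [hPL x]
  · rw [gradient_const_add_sub hf]
    have := hdesc (xstar + x) (xstar + y)
    rw [add_sub_add_left_eq_sub] at this
    linarith
  · simp only [add_sub_cancel]
    refine ⟨hgrow x, ?_⟩
    have h := hdesc xstar x
    rw [(hxstar xstar).2 rfl, inner_zero_left, hmin] at h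
    linarith

end Lyapunov

/-! ### Deterministic inequalities for one step. -/

section ScalarBounds

/-- A quantitative first-order Taylor estimate for powers. -/
theorem exists_add_pow_le (k : ℕ) : ∃ C : ℝ, 0 ≤ C ∧ ∀ D s : ℝ, 0 ≤ D →
    |(D + s) ^ (k + 2) - D ^ (k + 2) - (k + 2) * D ^ (k + 1) * s| ≤
      C * (s ^ 2 * (D + |s|) ^ k) := by
  induction k with
  | zero =>
    refine ⟨1, zero_le_one, fun D s _ => le_of_eq ?_⟩
    have : (D + s) ^ (0 + 2) - D ^ (0 + 2) - ((0 : ℕ) + 2) * D ^ (0 + 1) * s = s ^ 2 := by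
      push_cast; ring
    rw [this, abs_of_nonneg (sq_nonneg s)]; ring
  | succ k ih =>
    obtain ⟨C, hC, h⟩ := ih
    refine ⟨C + (k + 2), by positivity, fun D s hD => ?_⟩
    -- The new remainder is `D + s` times the old one plus a multiple of `s ^ 2`, which also
    -- explains the constant `C + (k + 2)`.
    have e : (D + s) ^ (k + 1 + 2) - D ^ (k + 1 + 2) - ((k + 1 : ℕ) + 2) * D ^ (k + 1 + 1) * s =
        (D + s) * ((D + s) ^ (k + 2) - D ^ (k + 2) - (k + 2) * D ^ (k + 1) * s) +
          (k + 2) * (D ^ (k + 1) * s ^ 2) := by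
      push_cast; ring
    have h1 : |D + s| ≤ D + |s| := (abs_add_le D s).trans_eq (by rw [abs_of_nonneg hD])
    have h2 : D ^ (k + 1) ≤ (D + |s|) ^ (k + 1) := by
      gcongr; linarith [abs_nonneg s]
    rw [e]
    refine (abs_add_le _ _).trans ?_
    rw [abs_mul, abs_of_nonneg (show 0 ≤ (k + 2) * (D ^ (k + 1) * s ^ 2) by positivity)]
    calc _ ≤ (D + |s|) * (C * (s ^ 2 * (D + |s|) ^ k)) +
          (k + 2) * ((D + |s|) ^ (k + 1) * s ^ 2) := by
          gcongr
          exact h D s hD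
      _ = _ := by ring

/-- This trades second moments for `p`-th moments uniformly in `p`: for `p ≤ 2` truncation gives `(α
* t) ^ 2 ≤ (α * t) ^ p`, and for `p ≥ 2` one has `t ^ 2 ≤ 1 + t ^ p`. -/
theorem sq_mul_le_add_rpow {α t p : ℝ} (hα : 0 < α) (ht : 0 ≤ t) (hu : α * t ≤ 1) :
    (α * t) ^ 2 ≤ α ^ 2 * (1 + t ^ p) + (α * t) ^ p := by
  have h1 : 0 ≤ (α * t) ^ p := by positivity
  have h2 : 0 ≤ t ^ p := by positivity
  rcases ht.eq_or_lt with rfl | ht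
  · rw [mul_zero, zero_pow two_ne_zero] at *
    positivity
  rcases le_total p 2 with hp | hp
  · have h3 : (α * t) ^ (2 : ℝ) ≤ (α * t) ^ p :=
      Real.rpow_le_rpow_of_exponent_ge (by positivity) hu hp
    rw [Real.rpow_two] at h3
    have : 0 ≤ α ^ 2 * (1 + t ^ p) := by positivity
    linarith
  · have h3 : t ^ 2 ≤ 1 + t ^ p := by
      rcases le_total t 1 with h | h
      · have : t ^ 2 ≤ 1 := pow_le_one₀ ht.le h
        linarith
      · have := Real.rpow_le_rpow_of_exponent_le h hp
        rw [Real.rpow_two] at this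
        linarith
    rw [mul_pow]
    have := mul_le_mul_of_nonneg_left h3 (sq_nonneg α)
    linarith

set_option maxHeartbeats 1000000 in
/-- One step of the recursion for powers of a Lyapunov function, with the noise truncated at
level `(1 + n) / α`. -/
theorem exists_truncated_step_bound {p ℓ : ℝ} (hp : 1 ≤ p) (hℓ : 1 ≤ ℓ) (k : ℕ)
    (hk : p ≤ k + 2) : ∃ C : ℝ, 0 ≤ C ∧ ∀ α D φ n W I : ℝ, 0 < α → 0 ≤ n → 0 ≤ W →
      0 ≤ D → D ≤ ℓ * n ^ 2 → 0 ≤ φ → |I| ≤ ℓ * n * W → φ ≤ D + α * I + ℓ * (α * W) ^ 2 →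
      (if α * W ≤ 1 + n then φ ^ (k + 2) else 0) ≤
        D ^ (k + 2) + (k + 2) * D ^ (k + 1) * (α * I) +
        C * (α ^ 2 * n ^ (2 * k + 2) * (1 + n) ^ 2 * (1 + (W / (1 + n)) ^ p) +
          α ^ p * (1 + n) ^ (2 * k + 4) * (W / (1 + n)) ^ p) := by
  obtain ⟨C, hC, hTaylor⟩ := exists_add_pow_le k
  -- `Q` collects the constants of the Taylor remainder; `R` those of the linear Taylor term,
  -- applied to the quadratic part of the increment when the noise is below the level and to `α * I`
  -- when it is above.
  set Q : ℝ := C * (2 * ℓ ^ 2 * (2 * ℓ) ^ k * 2 ^ k)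
  set R : ℝ := (k + 2) * ℓ ^ (k + 2)
  have hQ : 0 ≤ Q := by positivity
  have hR : 0 ≤ R := by positivity
  refine ⟨2 * Q + R, by positivity, fun α D φ n W I hα hn hW hD hDn hφ hI hstep => ?_⟩
  set N := 1 + n with hN
  have hN1 : 1 ≤ N := by linarith
  have hN0 : 0 < N := by linarith
  have hnN : n ≤ N := by linarith
  set t := W / N with ht
  have ht0 : 0 ≤ t := by positivity
  have hWt : W = N * t := by rw [ht]; field_simp
  have hup : α ^ p * N ^ (2 * k + 4) * t ^ p = N ^ (2 * k + 4) * (α * t) ^ p := by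
    rw [Real.mul_rpow hα.le ht0]; ring
  have htp : 0 ≤ t ^ p := by positivity
  set X := N ^ (2 * k + 4) * (α * t) ^ p with hX
  have hX0 : 0 ≤ X := by positivity
  set Y := α ^ 2 * n ^ (2 * k + 2) * N ^ 2 * (1 + t ^ p) with hY
  have hY0 : 0 ≤ Y := by positivity
  have hDk : D ^ (k + 1) ≤ ℓ ^ (k + 1) * n ^ (2 * k + 2) := by
    calc D ^ (k + 1) ≤ (ℓ * n ^ 2) ^ (k + 1) := by gcongr
      _ = _ := by rw [mul_pow, ← pow_mul]; ring_nf
  rw [hup]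
  split_ifs with h
  · have hu : α * t ≤ 1 := by
      rw [hWt] at h
      by_contra! hc
      nlinarith
    have hu0 : 0 ≤ α * t := by positivity
    set y := α * W with hy
    have hy0 : 0 ≤ y := by positivity
    have hyu : y = N * (α * t) := by rw [hy, hWt]; ring
    have hy2 : n ^ (2 * k + 2) * y ^ 2 ≤ Y + X := by
      have h1 := sq_mul_le_add_rpow (p := p) hα ht0 hu
      calc n ^ (2 * k + 2) * y ^ 2 = n ^ (2 * k + 2) * N ^ 2 * (α * t) ^ 2 := by
            rw [hyu, mul_pow]; ring
        _ ≤ n ^ (2 * k + 2) * N ^ 2 * (α ^ 2 * (1 + t ^ p) + (α * t) ^ p) := by gcongr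
        _ = Y + n ^ (2 * k + 2) * N ^ 2 * (α * t) ^ p := by rw [hY]; ring
        _ ≤ Y + N ^ (2 * k + 2) * N ^ 2 * (α * t) ^ p := by gcongr
        _ = Y + X := by rw [hX]; ring
    -- Since `α * t ≤ 1`, the exponent `2 * k + 4 ≥ p` may be lowered to `p`.
    have hym : y ^ (2 * k + 4) ≤ X := by
      rw [hyu, mul_pow, hX]
      gcongr
      rcases hu0.eq_or_lt with h0 | h0
      · rw [← h0, zero_pow (by omega)]
        positivity
      · rw [← Real.rpow_natCast]
        apply Real.rpow_le_rpow_of_exponent_ge h0 hu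
        push_cast
        linarith
    set s := α * I + ℓ * y ^ 2 with hs
    have hsabs : |s| ≤ ℓ * y * (n + y) := by
      rw [hs]
      refine (abs_add_le _ _).trans ?_
      rw [abs_mul, abs_of_pos hα, abs_of_nonneg (show 0 ≤ ℓ * y ^ 2 by positivity)]
      calc α * |I| + ℓ * y ^ 2 ≤ α * (ℓ * n * W) + ℓ * y ^ 2 := by gcongr
        _ = _ := by rw [hy]; ring
    have hs2 : s ^ 2 ≤ 2 * ℓ ^ 2 * (y ^ 2 * (n ^ 2 + y ^ 2)) := by
      calc s ^ 2 = |s| ^ 2 := (sq_abs s).symm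
        _ ≤ (ℓ * y * (n + y)) ^ 2 := by gcongr
        _ = ℓ ^ 2 * y ^ 2 * (n + y) ^ 2 := by ring
        _ ≤ ℓ ^ 2 * y ^ 2 * (2 * (n ^ 2 + y ^ 2)) := by
          gcongr
          nlinarith [sq_nonneg (n - y)]
        _ = _ := by ring
    have hDs : D + |s| ≤ 2 * ℓ * (n ^ 2 + y ^ 2) := by
      calc D + |s| ≤ ℓ * n ^ 2 + ℓ * y * (n + y) := add_le_add hDn hsabs
        _ = ℓ * (n ^ 2 + n * y + y ^ 2) := by ring
        _ ≤ ℓ * (2 * (n ^ 2 + y ^ 2)) := by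
          gcongr
          linarith [sq_nonneg (n - y), sub_sq n y, sq_nonneg n, sq_nonneg y]
        _ = _ := by ring
    have hrem : C * (s ^ 2 * (D + |s|) ^ k) ≤ 2 * Q * (Y + X) := by
      have h1 : (n ^ 2 + y ^ 2) ^ (k + 1) ≤ 2 ^ k * (n ^ (2 * k + 2) + y ^ (2 * k + 2)) := by
        have := add_pow_le (sq_nonneg n) (sq_nonneg y) (k + 1)
        rw [← pow_mul, ← pow_mul] at this
        simpa [mul_add] using this
      calc C * (s ^ 2 * (D + |s|) ^ k) ≤ C * ((2 * ℓ ^ 2 * (y ^ 2 * (n ^ 2 + y ^ 2))) *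
            (2 * ℓ * (n ^ 2 + y ^ 2)) ^ k) := by gcongr
        _ = C * (2 * ℓ ^ 2 * (2 * ℓ) ^ k) * y ^ 2 * (n ^ 2 + y ^ 2) ^ (k + 1) := by
          rw [mul_pow (2 * ℓ)]; ring
        _ ≤ C * (2 * ℓ ^ 2 * (2 * ℓ) ^ k) * y ^ 2 *
            (2 ^ k * (n ^ (2 * k + 2) + y ^ (2 * k + 2))) := by gcongr
        _ = Q * (n ^ (2 * k + 2) * y ^ 2 + y ^ (2 * k + 4)) := by ring
        _ ≤ Q * ((Y + X) + (Y + X)) := by gcongr; linarith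
        _ = _ := by ring
    have hlin : (k + 2) * D ^ (k + 1) * (ℓ * y ^ 2) ≤ R * (Y + X) := by
      calc (k + 2) * D ^ (k + 1) * (ℓ * y ^ 2)
          ≤ (k + 2) * (ℓ ^ (k + 1) * n ^ (2 * k + 2)) * (ℓ * y ^ 2) := by gcongr
        _ = R * (n ^ (2 * k + 2) * y ^ 2) := by ring
        _ ≤ _ := by gcongr
    have hpow : φ ^ (k + 2) ≤ (D + s) ^ (k + 2) := by
      gcongr
      linarith
    have hT := (abs_le.1 (hTaylor D s hD)).2
    have e : (k + 2) * D ^ (k + 1) * s =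
        (k + 2) * D ^ (k + 1) * (α * I) + (k + 2) * D ^ (k + 1) * (ℓ * y ^ 2) := by
      rw [hs]; ring
    linarith
  -- Above the level the left side is zero, but the linear term on the right may be negative. It
  -- stays untruncated so that it has mean zero, and `α * t ≤ (α * t) ^ p` lets the error term
  -- compensate it.
  · have hu : 1 ≤ α * t := by
      rw [hWt] at h
      by_contra! hc
      nlinarith
    have h1 : α * t ≤ (α * t) ^ p := Real.self_le_rpow_of_one_le hu hp
    have h2 : (k + 2) * D ^ (k + 1) * (α * |I|) ≤ R * X := by
      calc (k + 2) * D ^ (k + 1) * (α * |I|)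
          ≤ (k + 2) * (ℓ ^ (k + 1) * n ^ (2 * k + 2)) * (α * (ℓ * n * W)) := by gcongr
        _ = R * (n ^ (2 * k + 2) * n * N * (α * t)) := by rw [hWt]; ring
        _ ≤ R * (N ^ (2 * k + 2) * N * N * (α * t) ^ p) := by gcongr
        _ = R * X := by ring
    have h3 : -((k + 2) * D ^ (k + 1) * (α * |I|)) ≤ (k + 2) * D ^ (k + 1) * (α * I) := by
      have : -|I| ≤ I := neg_abs_le I
      have h4 : 0 ≤ (k + 2) * D ^ (k + 1) * α := by positivity
      linarith [mul_le_mul_of_nonneg_left this h4]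
    have h5 : 0 ≤ D ^ (k + 2) := by positivity
    have h6 : R * X ≤ (2 * Q + R) * (Y + X) := by
      have : 0 ≤ 2 * Q * (Y + X) + R * Y := by positivity
      linarith
    linarith

set_option maxHeartbeats 1000000 in
/-- The error terms of a step are absorbed by the drift, up to a term of order `α ^ p`. -/
theorem exists_drift_bound {p c μ C M : ℝ} (hc : 0 < c) (hμ : 0 < μ) (hC : 0 ≤ C) (hM : 0 ≤ M)
    (k : ℕ) (hk : p ≤ k + 2) : ∃ δ C' : ℝ, 0 < δ ∧ 0 ≤ C' ∧ ∀ α φ n : ℝ, 0 < α → α ≤ δ →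
      α ^ (p - 1) ≤ δ → 0 ≤ n → c * n ^ 2 ≤ φ →
      ((1 - μ * α) * φ) ^ (k + 2) +
        C * (α ^ 2 * n ^ (2 * k + 2) * (1 + n) ^ 2 * (1 + M) +
          α ^ p * (1 + n) ^ (2 * k + 4) * M) ≤
        (1 - μ / 2 * α) * φ ^ (k + 2) + C' * α ^ p := by
  set c' := (c ^ (k + 2))⁻¹ with hc'
  have hc'0 : 0 < c' := by positivity
  set G := 2 * C * (1 + M) with hG
  set F := C * 2 ^ (2 * k + 4) * M with hF
  have hG0 : 0 ≤ G := by positivity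
  have hF0 : 0 ≤ F := by positivity
  -- Half of the drift `μ * α * V` is given up: a quarter to the Young term through `ε`, a quarter
  -- to the remaining small terms through `δ`.
  obtain ⟨ε, hε, hεG⟩ : ∃ ε : ℝ, 0 < ε ∧ G * c' * ε ≤ μ / 4 := by
    refine ⟨μ / (4 * (G * c' + 1)), by positivity, ?_⟩
    rw [mul_div_assoc', div_le_div_iff₀ (by positivity) (by norm_num)]
    nlinarith [mul_nonneg hG0 hc'0.le]
  obtain ⟨δ, hδ, hδ1, hδμ, hδF⟩ : ∃ δ : ℝ, 0 < δ ∧ δ ≤ 1 ∧ μ * δ ≤ 1 ∧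
      (G * c' + F * c') * δ ≤ μ / 4 := by
    refine ⟨min 1 (min μ⁻¹ (μ / (4 * (G * c' + F * c' + 1)))), by positivity, min_le_left _ _,
      ?_, ?_⟩
    · calc μ * _ ≤ μ * μ⁻¹ := by
            gcongr; exact (min_le_right _ _).trans (min_le_left _ _)
        _ = 1 := mul_inv_cancel₀ hμ.ne'
    · have h0 : 0 ≤ G * c' + F * c' := by positivity
      calc (G * c' + F * c') * _ ≤ (G * c' + F * c') * (μ / (4 * (G * c' + F * c' + 1))) := by
            gcongr; exact (min_le_right _ _).trans (min_le_right _ _)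
        _ ≤ μ / 4 := by
          rw [mul_div_assoc', div_le_div_iff₀ (by positivity) (by norm_num)]
          nlinarith
  refine ⟨δ, G * (ε⁻¹) ^ (k + 1) + F, hδ, by positivity, fun α φ n hα hαδ hαp hn hφ => ?_⟩
  have hφ0 : 0 ≤ φ := le_trans (by positivity) hφ
  have hα1 : α ≤ 1 := hαδ.trans hδ1
  have hμα : μ * α ≤ 1 := le_trans (by gcongr) hδμ
  set V := φ ^ (k + 2) with hV
  have hV0 : 0 ≤ V := by positivity
  have hnV : n ^ (2 * k + 4) ≤ c' * V := by
    rw [hc', ← div_eq_inv_mul, le_div_iff₀ (by positivity)]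
    calc n ^ (2 * k + 4) * c ^ (k + 2) = (c * n ^ 2) ^ (k + 2) := by
          rw [mul_pow, ← pow_mul]; ring_nf
      _ ≤ V := by rw [hV]; gcongr
  have hαp0 : 0 < α ^ p := by positivity
  have hαpp : α ^ p = α * α ^ (p - 1) := by
    rw [Real.rpow_sub_one hα.ne']; field_simp
  have hdrift : ((1 - μ * α) * φ) ^ (k + 2) ≤ (1 - μ * α) * V := by
    have h0 : 0 ≤ μ * α := by positivity
    rw [mul_pow, ← hV]
    gcongr
    exact pow_le_of_le_one (by linarith) (by linarith) (by omega)
  -- Young's inequality, by comparing `α` with `ε * n ^ 2`. A further factor `α` turns the last term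
  -- into `α ^ (k + 3)`, which is at most `α ^ p` because `p ≤ k + 2` and `α ≤ 1`.
  have hYoung : α * n ^ (2 * k + 2) ≤ ε * n ^ (2 * k + 4) + (ε⁻¹) ^ (k + 1) * α ^ (k + 2) := by
    rcases le_total α (ε * n ^ 2) with h | h
    · calc α * n ^ (2 * k + 2) ≤ ε * n ^ 2 * n ^ (2 * k + 2) := by gcongr
        _ = ε * n ^ (2 * k + 4) := by ring
        _ ≤ _ := by
          have : 0 ≤ (ε⁻¹) ^ (k + 1) * α ^ (k + 2) := by positivity
          linarith
    · have h1 : n ^ 2 ≤ ε⁻¹ * α := by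
        rw [← div_eq_inv_mul, le_div_iff₀ hε]; linarith
      calc α * n ^ (2 * k + 2) = α * (n ^ 2) ^ (k + 1) := by rw [← pow_mul]; ring_nf
        _ ≤ α * (ε⁻¹ * α) ^ (k + 1) := by gcongr
        _ = (ε⁻¹) ^ (k + 1) * α ^ (k + 2) := by rw [mul_pow]; ring
        _ ≤ _ := by
          have : 0 ≤ ε * n ^ (2 * k + 4) := by positivity
          linarith
  have hαk : α * α ^ (k + 2) ≤ α ^ p := by
    calc α * α ^ (k + 2) ≤ 1 * α ^ (k + 2) := by gcongr
      _ = α ^ ((k + 2 : ℕ) : ℝ) := by rw [Real.rpow_natCast, one_mul]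
      _ ≤ α ^ p := Real.rpow_le_rpow_of_exponent_ge hα hα1 (by push_cast; exact hk)
  have hone : (1 + n) ^ 2 ≤ 2 * (1 + n ^ 2) := by nlinarith [sq_nonneg (1 - n)]
  have hbig : (1 + n) ^ (2 * k + 4) ≤ 2 ^ (2 * k + 4) * (1 + n ^ (2 * k + 4)) := by
    have := add_pow_le zero_le_one hn (2 * k + 4)
    rw [one_pow] at this
    refine this.trans ?_
    gcongr
    · norm_num
    · omega
  have hterm1 : C * (α ^ 2 * n ^ (2 * k + 2) * (1 + n) ^ 2 * (1 + M)) ≤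
      μ / 4 * α * V + G * (ε⁻¹) ^ (k + 1) * α ^ p + G * c' * α * (α * V) := by
    calc C * (α ^ 2 * n ^ (2 * k + 2) * (1 + n) ^ 2 * (1 + M))
        ≤ C * (α ^ 2 * n ^ (2 * k + 2) * (2 * (1 + n ^ 2)) * (1 + M)) := by gcongr
      _ = G * α * (α * n ^ (2 * k + 2)) + G * α ^ 2 * n ^ (2 * k + 4) := by rw [hG]; ring
      _ ≤ G * α * (ε * n ^ (2 * k + 4) + (ε⁻¹) ^ (k + 1) * α ^ (k + 2)) +
          G * α ^ 2 * n ^ (2 * k + 4) := by gcongr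
      _ = G * α * ε * n ^ (2 * k + 4) + G * (ε⁻¹) ^ (k + 1) * (α * α ^ (k + 2)) +
          G * α ^ 2 * n ^ (2 * k + 4) := by ring
      _ ≤ G * α * ε * (c' * V) + G * (ε⁻¹) ^ (k + 1) * α ^ p + G * α ^ 2 * (c' * V) := by gcongr
      _ = (G * c' * ε) * (α * V) + G * (ε⁻¹) ^ (k + 1) * α ^ p + G * c' * α * (α * V) := by ring
      _ ≤ μ / 4 * (α * V) + G * (ε⁻¹) ^ (k + 1) * α ^ p + G * c' * α * (α * V) := by gcongr
      _ = _ := by ring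
  have hterm2 : C * (α ^ p * (1 + n) ^ (2 * k + 4) * M) ≤
      F * α ^ p + F * c' * α ^ (p - 1) * (α * V) := by
    calc C * (α ^ p * (1 + n) ^ (2 * k + 4) * M)
        ≤ C * (α ^ p * (2 ^ (2 * k + 4) * (1 + n ^ (2 * k + 4))) * M) := by gcongr
      _ = F * α ^ p + F * α ^ p * n ^ (2 * k + 4) := by rw [hF]; ring
      _ ≤ F * α ^ p + F * α ^ p * (c' * V) := by gcongr
      _ = F * α ^ p + F * c' * α ^ (p - 1) * (α * V) := by
        nth_rewrite 2 [hαpp]; ring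
  have hsmall : (G * c' * α + F * c' * α ^ (p - 1)) * (α * V) ≤ μ / 4 * (α * V) := by
    gcongr
    calc G * c' * α + F * c' * α ^ (p - 1) ≤ G * c' * δ + F * c' * δ := by gcongr
      _ ≤ μ / 4 := by linarith
  rw [mul_add C]
  linarith

end ScalarBounds

/-! ### Consequences of the conditional noise assumptions. -/

section Conditional

variable {Ω E : Type*} {m m0 : MeasurableSpace Ω} {P : Measure[m0] Ω} [IsProbabilityMeasure P]
  [NormedAddCommGroup E]

/-- The measures with densities `X` and `P⁻[X | m]` agree on `m`, so they integrate `ψ` equally; no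
integrability is involved. -/
theorem lintegral_mul_condLExp (hm : m ≤ m0) {ψ X : Ω → ℝ≥0∞} (hψ : Measurable[m] ψ)
    (hX : Measurable[m0] X) : ∫⁻ ω, ψ ω * P⁻[X | m] ω ∂P = ∫⁻ ω, ψ ω * X ω ∂P := by
  have h1 : (P.withDensity X).trim hm = (P.withDensity P⁻[X | m]).trim hm := by
    refine @Measure.ext _ m _ _ fun s hs => ?_
    rw [trim_measurableSet_eq hm hs, trim_measurableSet_eq hm hs, withDensity_apply _ (hm s hs),
      withDensity_apply _ (hm s hs), setLIntegral_condLExp hm P X hs]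
  have h2 : ∀ Y : Ω → ℝ≥0∞, Measurable[m0] Y →
      ∫⁻ ω, ψ ω * Y ω ∂P = ∫⁻ ω, ψ ω ∂((P.withDensity Y).trim hm) := by
    intro Y hY
    rw [lintegral_trim hm hψ, lintegral_withDensity_eq_lintegral_mul _ hY (hψ.mono hm le_rfl)]
    simp [mul_comm]
  rw [h2 _ hX, h2 _ (measurable_condLExp' m P X), h1]

theorem lintegral_mul_le_of_condLExp_le (hm : m ≤ m0) {ψ X Y : Ω → ℝ≥0∞} (hψ : Measurable[m] ψ)
    (hX : Measurable[m0] X) (hY : P⁻[X | m] ≤ᵐ[P] Y) :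
    ∫⁻ ω, ψ ω * X ω ∂P ≤ ∫⁻ ω, ψ ω * Y ω ∂P := by
  rw [← lintegral_mul_condLExp hm hψ hX]
  refine lintegral_mono_ae ?_
  filter_upwards [hY] with ω h
  gcongr

/-- Cutting `G` off outside `S` makes it bounded, so the product with `w` is integrable and `G` can
be pulled out of the conditional expectation. -/
theorem setIntegral_inner_eq_zero [InnerProductSpace ℝ E] [CompleteSpace E] (hm : m ≤ m0) {w G : Ω → E} (hw : Integrable w P)
    (h0 : P[w | m] =ᵐ[P] 0) {S : Set Ω} (hS : MeasurableSet[m] S) (hG : StronglyMeasurable[m] G)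
    {κ : ℝ} (hGκ : ∀ ω ∈ S, ‖G ω‖ ≤ κ) :
    IntegrableOn (fun ω => inner ℝ (G ω) (w ω)) S P ∧ ∫ ω in S, inner ℝ (G ω) (w ω) ∂P = 0 := by
  have hGS : StronglyMeasurable[m] (S.indicator G) := hG.indicator hS
  have hint : Integrable (fun ω => innerSL ℝ (S.indicator G ω) (w ω)) P := by
    refine (hw.norm.const_mul |κ|).mono' ?_ (ae_of_all _ fun ω => ?_)
    · exact (hGS.mono hm).aestronglyMeasurable.inner hw.aestronglyMeasurable
    · refine (norm_inner_le_norm _ _).trans ?_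
      gcongr
      by_cases h : ω ∈ S
      · rw [Set.indicator_of_mem h]; exact (hGκ ω h).trans (le_abs_self κ)
      · rw [Set.indicator_of_notMem h, norm_zero]; exact abs_nonneg κ
  have heq : (fun ω => innerSL ℝ (S.indicator G ω) (w ω)) =
      S.indicator fun ω => inner ℝ (G ω) (w ω) := by
    ext ω
    by_cases h : ω ∈ S <;> simp [h]
  refine ⟨(integrable_indicator_iff (hm S hS)).1 (heq ▸ hint), ?_⟩
  rw [← integral_indicator (hm S hS), ← heq, ← integral_condExp hm]
  refine integral_eq_zero_of_ae ?_
  filter_upwards [condExp_bilin_of_stronglyMeasurable_left (innerSL ℝ) hGS hint hw, h0] with ω h1 h2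
  rw [h1, h2]
  simp

/-- The noise need not have a finite unconditional `p`-th moment. The comparison is therefore made
between `[0,∞]`-valued integrals over `S`, and integrability is a conclusion. -/
theorem setIntegral_mul_rpow_norm_le [MeasurableSpace E] [BorelSpace E] (hm : m ≤ m0) {w : Ω → E}
    (hw : Measurable[m0] w) {p : ℝ} (hp : 0 ≤ p) {Y Z : Ω → ℝ}
    (hY : P⁻[fun ω => ‖w ω‖ₑ ^ p | m] ≤ᵐ[P] fun ω => ENNReal.ofReal (Y ω))
    {S : Set Ω} (hS : MeasurableSet[m] S) (hZ : Measurable[m] Z) (hZ0 : ∀ ω ∈ S, 0 ≤ Z ω)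
    (hY0 : ∀ ω ∈ S, 0 ≤ Y ω) (hZY : IntegrableOn (fun ω => Z ω * Y ω) S P) :
    IntegrableOn (fun ω => Z ω * ‖w ω‖ ^ p) S P ∧
      ∫ ω in S, Z ω * ‖w ω‖ ^ p ∂P ≤ ∫ ω in S, Z ω * Y ω ∂P := by
  have hmeas : Measurable[m0] fun ω => Z ω * ‖w ω‖ ^ p :=
    (hZ.mono hm le_rfl).mul (hw.norm.pow_const p)
  have hX : Measurable[m0] fun ω => ‖w ω‖ₑ ^ p := hw.enorm.pow_const p
  have h1 : ∫⁻ ω in S, ENNReal.ofReal (Z ω * ‖w ω‖ ^ p) ∂P ≤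
      ∫⁻ ω in S, ENNReal.ofReal (Z ω * Y ω) ∂P := by
    have h := lintegral_mul_le_of_condLExp_le hm
      (ψ := S.indicator fun ω => ENNReal.ofReal (Z ω)) (hZ.ennreal_ofReal.indicator hS) hX hY
    rw [← lintegral_indicator (hm S hS), ← lintegral_indicator (hm S hS)]
    refine (le_of_eq ?_).trans (h.trans (le_of_eq ?_)) <;> congr 1 <;> ext ω <;>
      by_cases hω : ω ∈ S
    · simp only [hω, Set.indicator_of_mem]
      rw [ENNReal.ofReal_mul (hZ0 ω hω), ← ENNReal.ofReal_rpow_of_nonneg (norm_nonneg _) hp,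
        ofReal_norm]
    · simp [hω]
    · simp only [hω, Set.indicator_of_mem]
      rw [ENNReal.ofReal_mul (hZ0 ω hω)]
    · simp [hω]
  have hpos : 0 ≤ᵐ[P.restrict S] fun ω => Z ω * ‖w ω‖ ^ p := by
    filter_upwards [ae_restrict_mem (hm S hS)] with ω hω
    have := hZ0 ω hω
    positivity
  have hpos' : 0 ≤ᵐ[P.restrict S] fun ω => Z ω * Y ω := by
    filter_upwards [ae_restrict_mem (hm S hS)] with ω hω
    exact mul_nonneg (hZ0 ω hω) (hY0 ω hω)
  have hfin := (hasFiniteIntegral_iff_ofReal hpos').1 hZY.2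
  refine ⟨⟨hmeas.aestronglyMeasurable, (hasFiniteIntegral_iff_ofReal hpos).2 (h1.trans_lt hfin)⟩, ?_⟩
  rw [integral_eq_lintegral_of_nonneg_ae hpos hmeas.aestronglyMeasurable,
    integral_eq_lintegral_of_nonneg_ae hpos' hZY.1]
  exact ENNReal.toReal_mono hfin.ne h1

theorem integrableOn_of_abs_le (hm : m ≤ m0) {S : Set Ω} (hS : MeasurableSet[m] S) {f : Ω → ℝ}
    (hf : Measurable[m0] f) {κ : ℝ} (hκ : ∀ ω ∈ S, |f ω| ≤ κ) : IntegrableOn f S P := by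
  refine (integrable_const κ).mono' hf.aestronglyMeasurable ?_
  filter_upwards [ae_restrict_mem (hm S hS)] with ω hω using hκ ω hω

/-- The noise exceeds the truncation level `(1 + ‖x - xstar‖) / α` with probability `O(α ^ p)`. -/
theorem measure_lt_mul_norm_le [MeasurableSpace E] [BorelSpace E] {p A B : ℝ} (hp : 0 ≤ p)
    (hA : 0 ≤ A) (hB : 0 ≤ B) (hm : m ≤ m0) {x w : Ω → E} {xstar : E} (hx : Measurable[m] x) (hw : Measurable[m0] w)
    (hwp : P⁻[fun ω => ‖w ω‖ₑ ^ p | m] ≤ᵐ[P]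
      fun ω => ENNReal.ofReal (A + B * ‖x ω - xstar‖ ^ p)) {α : ℝ} (hα : 0 ≤ α) :
    P {ω | 1 + ‖x ω - xstar‖ < α * ‖w ω‖} ≤ ENNReal.ofReal ((A + B) * α ^ p) := by
  have hnm : Measurable[m] fun ω => ‖x ω - xstar‖ :=
    (continuous_id.sub continuous_const).norm.measurable.comp hx
  have hψ : Measurable[m] fun ω => ENNReal.ofReal ((α / (1 + ‖x ω - xstar‖)) ^ p) :=
    (show Measurable fun t : ℝ => ENNReal.ofReal ((α / (1 + t)) ^ p) by fun_prop).comp hnm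
  have h := lintegral_mul_le_of_condLExp_le hm hψ (hw.enorm.pow_const p) hwp
  have hset : MeasurableSet[m0] {ω | 1 + ‖x ω - xstar‖ < α * ‖w ω‖} :=
    measurableSet_lt ((hnm.mono hm le_rfl).const_add 1) (hw.norm.const_mul α)
  rw [← lintegral_indicator_one hset]
  refine le_trans (lintegral_mono fun ω => ?_) (h.trans ?_)
  · by_cases hω : ω ∈ {ω | 1 + ‖x ω - xstar‖ < α * ‖w ω‖}
    · rw [Set.indicator_of_mem hω, Pi.one_apply, ← ofReal_norm,
        ENNReal.ofReal_rpow_of_nonneg (norm_nonneg _) hp, ← ENNReal.ofReal_mul (by positivity),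
        ← Real.mul_rpow (by positivity) (norm_nonneg _), ENNReal.one_le_ofReal]
      refine Real.one_le_rpow ?_ hp
      rw [div_mul_eq_mul_div, one_le_div (by positivity)]
      exact hω.le
    · rw [Set.indicator_of_notMem hω]
      exact zero_le
  · calc _ ≤ ∫⁻ _, ENNReal.ofReal ((A + B) * α ^ p) ∂P := by
          refine lintegral_mono fun ω => ?_
          rw [← ENNReal.ofReal_mul (by positivity)]
          refine ENNReal.ofReal_le_ofReal ?_
          have h0 := norm_nonneg (x ω - xstar)
          have h1 : 1 ≤ (1 + ‖x ω - xstar‖) ^ p := Real.one_le_rpow (by linarith) hp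
          have h2 : ‖x ω - xstar‖ ^ p ≤ (1 + ‖x ω - xstar‖) ^ p :=
            Real.rpow_le_rpow h0 (by linarith) hp
          have h3 : A + B * ‖x ω - xstar‖ ^ p ≤ (A + B) * (1 + ‖x ω - xstar‖) ^ p := by
            have := mul_le_mul_of_nonneg_left h1 hA
            have := mul_le_mul_of_nonneg_left h2 hB
            linarith
          rw [Real.div_rpow hα (by positivity)]
          calc _ ≤ α ^ p / (1 + ‖x ω - xstar‖) ^ p *
                ((A + B) * (1 + ‖x ω - xstar‖) ^ p) := by gcongr
            _ = _ := by field_simp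
      _ = _ := by simp

end Conditional

theorem measurable_ite_mul_le {Ω : Type*} [MeasurableSpace Ω] {α : ℝ} {W n φ : Ω → ℝ}
    (hW : Measurable W) (hn : Measurable n) (hφ : Measurable φ) :
    Measurable fun ω => if α * W ω ≤ 1 + n ω then φ ω else 0 :=
  Measurable.ite (measurableSet_le (hW.const_mul α) (hn.const_add 1)) hφ measurable_const

/-! ### The drift inequality for one random step. -/

section OneStep

variable {Ω E : Type*} {m0 : MeasurableSpace Ω} {P : Measure[m0] Ω} [IsProbabilityMeasure P]
  [NormedAddCommGroup E] [InnerProductSpace ℝ E] [CompleteSpace E] [MeasurableSpace E]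
  [BorelSpace E] [ProperSpace E]

/-- The drift inequality for one step of SGD with truncated noise, integrated over an event of the
past on which the current iterate is bounded. -/
theorem exists_setIntegral_step_le {f : E → ℝ} {L : ℝ≥0} (hf : Differentiable ℝ f)
    (hg : LipschitzWith L (gradient f)) {fstar μ : ℝ} (hlb : ∀ x, fstar ≤ f x) (hμ : 0 < μ)
    (hPL : ∀ x, μ * (f x - fstar) ≤ ‖gradient f x‖ ^ 2 / 2) {xstar : E}
    (hmin : f xstar = fstar) (hgrad : gradient f xstar = 0) {c : ℝ} (hc : 0 < c)
    (hgrow : ∀ x, c * ‖x - xstar‖ ^ 2 ≤ f x - fstar) {p A B : ℝ} (hp : 1 < p) (hA : 0 ≤ A)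
    (hB : 0 ≤ B) : ∃ (k : ℕ) (δ C : ℝ), 0 < δ ∧ 0 ≤ C ∧
      ∀ (m : MeasurableSpace Ω) (α R : ℝ) (x w x' : Ω → E) (S : Set Ω), 0 < α → α ≤ δ → α ^ (p - 1) ≤ δ → m ≤ m0 →
      Measurable[m] x → Measurable[m0] w → Integrable w P → P[w | m] =ᵐ[P] 0 →
      P⁻[fun ω => ‖w ω‖ₑ ^ p | m] ≤ᵐ[P]
        (fun ω => ENNReal.ofReal (A + B * ‖x ω - xstar‖ ^ p)) →
      (∀ ω, x' ω = x ω + α • (-gradient f (x ω) + w ω)) → MeasurableSet[m] S →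
      (∀ ω ∈ S, ‖x ω - xstar‖ ≤ R) →
      IntegrableOn (fun ω => if α * ‖w ω‖ ≤ 1 + ‖x ω - xstar‖ then
        (f (x' ω) - fstar) ^ (k + 2) else 0) S P ∧
      ∫ ω in S, (if α * ‖w ω‖ ≤ 1 + ‖x ω - xstar‖ then
        (f (x' ω) - fstar) ^ (k + 2) else 0) ∂P ≤
        ∫ ω in S, ((1 - μ / 2 * α) * (f (x ω) - fstar) ^ (k + 2) + C * α ^ p) ∂P := by
  obtain ⟨k, hk⟩ := exists_nat_ge p
  have hk2 : p ≤ k + 2 := by linarith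
  set ℓ : ℝ := L + 1 with hℓ
  have hℓ1 : 1 ≤ ℓ := by rw [hℓ]; linarith [L.coe_nonneg]
  have hM : 0 ≤ A + B := by positivity
  obtain ⟨C₁, hC₁, hstep⟩ := exists_truncated_step_bound hp.le hℓ1 k hk2
  obtain ⟨δ₀, C₂, hδ₀, hC₂, hdrift⟩ := exists_drift_bound (p := p) hc hμ hC₁ hM k hk2
  refine ⟨k, min δ₀ (min (1 / (2 * ℓ)) (min μ⁻¹ 1)), C₂, by positivity, hC₂, ?_⟩
  intro m α R x w x' S hα hαδ hαp hm hx hwm hw hw0 hwp hx' hS hxR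
  obtain ⟨hα₀, hα₁⟩ := le_min_iff.1 hαδ
  obtain ⟨hα₁, hα₂⟩ := le_min_iff.1 hα₁
  obtain ⟨hα₂, -⟩ := le_min_iff.1 hα₂
  have hαp₀ : α ^ (p - 1) ≤ δ₀ := hαp.trans (min_le_left _ _)
  have hμα : μ * α ≤ 1 := by
    calc μ * α ≤ μ * μ⁻¹ := by gcongr
      _ = 1 := mul_inv_cancel₀ hμ.ne'
  have hℓα : 2 * ℓ * α ≤ 1 := by
    rw [le_div_iff₀ (by positivity)] at hα₁; linarith
  have hgc : Continuous (gradient f) := hg.continuous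
  have hfc : Continuous f := hf.continuous
  have hgn : ∀ y, ‖gradient f y‖ ≤ ℓ * ‖y - xstar‖ := by
    intro y
    have := hg.dist_le_mul y xstar
    rw [hgrad, dist_zero_right, dist_eq_norm] at this
    refine this.trans ?_
    gcongr
    rw [hℓ]; linarith
  have hfu : ∀ y, f y - fstar ≤ ℓ * ‖y - xstar‖ ^ 2 := by
    intro y
    have h := le_add_inner_gradient_add_sq hf hg xstar y
    rw [hgrad, inner_zero_left, hmin] at h
    have : (L : ℝ) / 2 * ‖y - xstar‖ ^ 2 ≤ ℓ * ‖y - xstar‖ ^ 2 := by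
      gcongr
      rw [hℓ]; linarith [L.coe_nonneg]
    linarith
  set D : E → ℝ := fun y => (1 - μ * α) * (f y - fstar) with hD
  have hD0 : ∀ y, 0 ≤ D y := fun y => mul_nonneg (by linarith) (sub_nonneg.2 (hlb y))
  have hDu : ∀ y, D y ≤ ℓ * ‖y - xstar‖ ^ 2 := by
    intro y
    refine le_trans ?_ (hfu y)
    exact mul_le_of_le_one_left (sub_nonneg.2 (hlb y)) (by linarith [mul_pos hμ hα])
  -- In the descent lemma, `2 * ℓ * α ≤ 1` lets half of `α * ‖∇f‖ ^ 2` absorb the quadratic gradient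
  -- term; PL turns the other half into the factor `1 - μ * α` of `D`.
  have hone : ∀ y v : E, f (y + α • (-gradient f y + v)) - fstar ≤
      D y + α * inner ℝ (gradient f y) v + ℓ * (α * ‖v‖) ^ 2 := by
    intro y v
    have h := le_add_inner_gradient_add_sq hf hg y (y + α • (-gradient f y + v))
    rw [add_sub_cancel_left, inner_smul_right, inner_add_right, inner_neg_right,
      real_inner_self_eq_norm_sq, norm_smul, Real.norm_eq_abs, abs_of_pos hα, mul_pow] at h
    have h1 : ‖-gradient f y + v‖ ^ 2 ≤ 2 * (‖gradient f y‖ ^ 2 + ‖v‖ ^ 2) := by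
      have h2 := norm_add_le (-gradient f y) v
      rw [norm_neg] at h2
      have h3 := add_sq_le (a := ‖gradient f y‖) (b := ‖v‖)
      calc ‖-gradient f y + v‖ ^ 2 ≤ (‖gradient f y‖ + ‖v‖) ^ 2 := by gcongr
        _ ≤ _ := h3
    have h4 : (L : ℝ) / 2 * (α ^ 2 * ‖-gradient f y + v‖ ^ 2) ≤
        ℓ / 2 * (α ^ 2 * (2 * (‖gradient f y‖ ^ 2 + ‖v‖ ^ 2))) := by
      gcongr
      rw [hℓ]; linarith
    have h5 : ℓ * α * (α * ‖gradient f y‖ ^ 2) ≤ 1 / 2 * (α * ‖gradient f y‖ ^ 2) := by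
      gcongr; linarith
    have h6 := mul_le_mul_of_nonneg_left (hPL y) hα.le
    simp only [hD]
    nlinarith
  -- The scalar bound splits by its dependence on the noise: `U` is free of it, `G` is paired with
  -- `w` and integrates to zero, and `Z` is the coefficient of `‖w‖ ^ p`, bounded in the mean by
  -- `Y`.
  set U : E → ℝ := fun y => D y ^ (k + 2) +
    C₁ * (α ^ 2 * ‖y - xstar‖ ^ (2 * k + 2) * (1 + ‖y - xstar‖) ^ 2) with hU
  set G : E → E := fun y => ((k + 2) * D y ^ (k + 1) * α) • gradient f y with hG
  set Z : E → ℝ := fun y => C₁ * (α ^ 2 * ‖y - xstar‖ ^ (2 * k + 2) * (1 + ‖y - xstar‖) ^ 2 +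
    α ^ p * (1 + ‖y - xstar‖) ^ (2 * k + 4)) / (1 + ‖y - xstar‖) ^ p with hZ
  set Y : E → ℝ := fun y => A + B * ‖y - xstar‖ ^ p with hY
  have hnc : Continuous fun y : E => ‖y - xstar‖ := (continuous_id.sub continuous_const).norm
  have hDc : Continuous D := continuous_const.mul (hfc.sub continuous_const)
  have hUc : Continuous U := (hDc.pow _).add (continuous_const.mul
    ((continuous_const.mul (hnc.pow _)).mul ((continuous_const.add hnc).pow _)))
  have hGc : Continuous G := ((continuous_const.mul (hDc.pow _)).mul continuous_const).smul hgc
  have hpc : Continuous fun y : E => (1 + ‖y - xstar‖) ^ p :=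
    (continuous_const.add hnc).rpow_const fun y => Or.inr (by linarith)
  have hZc : Continuous Z := (continuous_const.mul
    (((continuous_const.mul (hnc.pow _)).mul ((continuous_const.add hnc).pow _)).add
      (continuous_const.mul ((continuous_const.add hnc).pow _)))).div hpc
      fun y => (by positivity)
  have hYc : Continuous Y := continuous_const.add (continuous_const.mul
    (hnc.rpow_const fun y => Or.inr (by linarith)))
  have hZ0 : ∀ y, 0 ≤ Z y := fun y => by simp only [hZ]; positivity
  have hY0 : ∀ y, 0 ≤ Y y := fun y => by simp only [hY]; positivity
  have hYp : ∀ y, Y y ≤ (A + B) * (1 + ‖y - xstar‖) ^ p := by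
    intro y
    have h1 : 1 ≤ (1 + ‖y - xstar‖) ^ p :=
      Real.one_le_rpow (by linarith [norm_nonneg (y - xstar)]) (by linarith)
    have h2 : ‖y - xstar‖ ^ p ≤ (1 + ‖y - xstar‖) ^ p :=
      Real.rpow_le_rpow (norm_nonneg _) (by linarith) (by linarith)
    simp only [hY]
    have := mul_le_mul_of_nonneg_left h1 hA
    have := mul_le_mul_of_nonneg_left h2 hB
    linarith
  have hpt : ∀ ω, (if α * ‖w ω‖ ≤ 1 + ‖x ω - xstar‖ then (f (x' ω) - fstar) ^ (k + 2) else 0) ≤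
      U (x ω) + inner ℝ (G (x ω)) (w ω) + Z (x ω) * ‖w ω‖ ^ p := by
    intro ω
    have hI : |inner ℝ (gradient f (x ω)) (w ω)| ≤ ℓ * ‖x ω - xstar‖ * ‖w ω‖ :=
      (abs_real_inner_le_norm _ _).trans (by gcongr; exact hgn _)
    have h := hstep α (D (x ω)) (f (x' ω) - fstar) ‖x ω - xstar‖ ‖w ω‖
      (inner ℝ (gradient f (x ω)) (w ω)) hα (norm_nonneg _) (norm_nonneg _) (hD0 _) (hDu _)
      (sub_nonneg.2 (hlb _)) hI (by rw [hx' ω]; exact hone _ _)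
    refine h.trans (le_of_eq ?_)
    simp only [hU, hG, hZ]
    rw [real_inner_smul_left, Real.div_rpow (norm_nonneg _) (by positivity)]
    ring
  have hpt' : ∀ y, U y + Z y * Y y ≤
      (1 - μ / 2 * α) * (f y - fstar) ^ (k + 2) + C₂ * α ^ p := by
    intro y
    refine le_trans ?_ (hdrift α (f y - fstar) ‖y - xstar‖ hα hα₀ hαp₀ (norm_nonneg _) (hgrow y))
    have h1 : Z y * Y y ≤ C₁ * (α ^ 2 * ‖y - xstar‖ ^ (2 * k + 2) * (1 + ‖y - xstar‖) ^ 2 +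
        α ^ p * (1 + ‖y - xstar‖) ^ (2 * k + 4)) * (A + B) := by
      refine (mul_le_mul_of_nonneg_left (hYp y) (hZ0 y)).trans (le_of_eq ?_)
      simp only [hZ]
      have : (1 + ‖y - xstar‖) ^ p ≠ 0 := by positivity
      field_simp
    simp only [hU, hD]
    linarith
  have hbdd : ∀ g : E → ℝ, Continuous g → IntegrableOn (fun ω => g (x ω)) S P := by
    intro g hgc
    obtain ⟨κ, hκ⟩ := (isCompact_closedBall xstar R).exists_bound_of_continuousOn hgc.continuousOn
    refine integrableOn_of_abs_le hm hS (hgc.measurable.comp (hx.mono hm le_rfl)) (κ := κ)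
      fun ω hω => hκ _ ?_
    rw [mem_closedBall_iff_norm]
    exact hxR ω hω
  obtain ⟨κ, hκ⟩ := (isCompact_closedBall xstar R).exists_bound_of_continuousOn hGc.continuousOn
  obtain ⟨hi1, he1⟩ := setIntegral_inner_eq_zero hm hw hw0 hS
    (hGc.measurable.comp hx).stronglyMeasurable (κ := κ)
    fun ω hω => hκ _ (by rw [mem_closedBall_iff_norm]; exact hxR ω hω)
  have hi2 : IntegrableOn (fun ω => Z (x ω) * Y (x ω)) S P := hbdd _ (hZc.mul hYc)
  obtain ⟨hi3, he3⟩ := setIntegral_mul_rpow_norm_le hm hwm (by linarith) hwp hS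
    (hZc.measurable.comp hx) (fun ω _ => hZ0 _) (fun ω _ => hY0 _) hi2
  have hiU : IntegrableOn (fun ω => U (x ω)) S P := hbdd _ hUc
  have hxm : Measurable[m0] x := hx.mono hm le_rfl
  have hxm' : Measurable[m0] x' := by
    have : x' = fun ω => x ω + α • (-gradient f (x ω) + w ω) := funext hx'
    rw [this]
    exact hxm.add (((hgc.measurable.comp hxm).neg.add hwm).const_smul α)
  have hiR : IntegrableOn
      (fun ω => U (x ω) + inner ℝ (G (x ω)) (w ω) + Z (x ω) * ‖w ω‖ ^ p) S P :=
    (hiU.add hi1).add hi3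
  have hint : IntegrableOn (fun ω => if α * ‖w ω‖ ≤ 1 + ‖x ω - xstar‖ then
        (f (x' ω) - fstar) ^ (k + 2) else 0) S P := by
    refine hiR.mono' (Measurable.aestronglyMeasurable ?_) (ae_of_all _ fun ω => ?_)
    · exact @measurable_ite_mul_le Ω m0 _ _ _ _ (measurable_norm.comp hwm) (hnc.measurable.comp hxm)
        (((hfc.sub continuous_const).pow (k + 2)).measurable.comp hxm')
    · rw [Real.norm_eq_abs, abs_of_nonneg]
      · exact hpt ω
      · have := sub_nonneg.2 (hlb (x' ω))
        positivity
  refine ⟨hint, ?_⟩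
  calc _ ≤ ∫ ω in S, (U (x ω) + inner ℝ (G (x ω)) (w ω) + Z (x ω) * ‖w ω‖ ^ p) ∂P :=
        integral_mono hint hiR hpt
    _ = ∫ ω in S, U (x ω) ∂P + ∫ ω in S, Z (x ω) * ‖w ω‖ ^ p ∂P := by
      have h1 := integral_add (hiU.add hi1) hi3
      have h2 := integral_add hiU hi1
      rw [he1, add_zero] at h2
      rw [← h2]
      exact h1
    _ ≤ ∫ ω in S, U (x ω) ∂P + ∫ ω in S, Z (x ω) * Y (x ω) ∂P := add_le_add le_rfl he3
    _ = ∫ ω in S, (U (x ω) + Z (x ω) * Y (x ω)) ∂P := (integral_add hiU hi2).symm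
    _ ≤ _ := by
      refine integral_mono (hiU.add hi2) (hbdd (fun y => (1 - μ / 2 * α) *
        (f y - fstar) ^ (k + 2) + C₂ * α ^ p) ?_) fun ω => hpt' _
      exact (continuous_const.mul ((hfc.sub continuous_const).pow _)).add continuous_const

end OneStep

/-! ### Almost supermartingales with divergent drift. -/

section AlmostSupermartingale

/-- Adding the tail sums of `b` makes `v` monotone, so it has a limit, and telescoping makes `∑ a k
* v k` finite. A positive limit would then make `a` summable. -/
theorem tendsto_zero_of_recursive_le {v a b : ℕ → ℝ} {c : ℝ} (hc : 0 < c) (hv : ∀ k, 0 ≤ v k)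
    (ha : ∀ k, 0 ≤ a k) (hasum : ¬ Summable a) (hb : ∀ k, 0 ≤ b k) (hbsum : Summable b)
    (h : ∀ k, v (k + 1) ≤ (1 - c * a k) * v k + b k) : Tendsto v atTop (𝓝 0) := by
  set T : ℕ → ℝ := fun k => ∑' j, b (j + k) with hT
  have hTsucc : ∀ k, T k = b k + T (k + 1) := by
    intro k
    simp only [hT]
    rw [((summable_nat_add_iff k).2 hbsum).tsum_eq_zero_add, zero_add]
    congr 2
    ext j
    congr 1
    ring
  have hT0 : ∀ k, 0 ≤ T k := fun k => tsum_nonneg fun j => hb _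
  have hTlim : Tendsto T atTop (𝓝 0) := tendsto_sum_nat_add b
  have hdec : ∀ k, v (k + 1) + T (k + 1) ≤ v k + T k - c * (a k * v k) := by
    intro k
    linarith [h k, hTsucc k]
  have hav : ∀ k, 0 ≤ a k * v k := fun k => mul_nonneg (ha k) (hv k)
  have hanti : Antitone fun k => v k + T k := antitone_nat_of_succ_le fun k =>
    (hdec k).trans (by linarith [mul_nonneg hc.le (hav k)])
  obtain ⟨l, hl⟩ : ∃ l, Tendsto (fun k => v k + T k) atTop (𝓝 l) :=
    ⟨_, tendsto_atTop_ciInf hanti ⟨0, by rintro _ ⟨k, rfl⟩; exact add_nonneg (hv k) (hT0 k)⟩⟩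
  have hvl : Tendsto v atTop (𝓝 l) := by simpa using hl.sub hTlim
  have hl0 : 0 ≤ l := ge_of_tendsto' hvl hv
  rcases hl0.eq_or_lt with rfl | hlpos
  · exact hvl
  exfalso
  apply hasum
  have hsum : Summable fun k => a k * v k := by
    refine summable_of_sum_range_le (c := (v 0 + T 0) / c) hav fun n => ?_
    rw [le_div_iff₀ hc]
    have : ∀ n, v n + T n + (∑ i ∈ Finset.range n, a i * v i) * c ≤ v 0 + T 0 := by
      intro n
      induction n with
      | zero => simp
      | succ n ih =>
        rw [Finset.sum_range_succ, add_mul]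
        linarith [hdec n]
    linarith [this n, hv n, hT0 n]
  refine Summable.of_norm_bounded_eventually_nat (hsum.mul_left (2 / l)) ?_
  filter_upwards [hvl.eventually_const_lt (half_lt_self hlpos)] with k hk
  rw [Real.norm_eq_abs, abs_of_nonneg (ha k)]
  calc a k = 2 / l * (a k * (l / 2)) := by field_simp
    _ ≤ 2 / l * (a k * v k) := by
      have := ha k
      gcongr

variable {Ω : Type*} {m0 : MeasurableSpace Ω} {P : Measure[m0] Ω} [IsProbabilityMeasure P]

/-- A nonnegative process whose conditional drift is at most `-c * a k * V k + b k`, with `∑ a`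
divergent and `∑ b` convergent, tends to zero almost surely. -/
theorem ae_tendsto_zero_of_setIntegral_le {ℱ : Filtration ℕ m0} {V : ℕ → Ω → ℝ} {a b : ℕ → ℝ}
    {c : ℝ} (hc : 0 < c) (hadp : StronglyAdapted ℱ V) (hint : ∀ k, Integrable (V k) P)
    (hV : ∀ k ω, 0 ≤ V k ω) (ha : ∀ k, 0 ≤ a k) (hasum : ¬ Summable a) (hb : ∀ k, 0 ≤ b k)
    (hbsum : Summable b) (h : ∀ k S, MeasurableSet[ℱ k] S →
      ∫ ω in S, V (k + 1) ω ∂P ≤ ∫ ω in S, ((1 - c * a k) * V k ω + b k) ∂P) :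
    ∀ᵐ ω ∂P, Tendsto (fun k => V k ω) atTop (𝓝 0) := by
  set T : ℕ → ℝ := fun k => ∑' j, b (j + k) with hT
  have hTsucc : ∀ k, T k = b k + T (k + 1) := by
    intro k
    simp only [hT]
    rw [((summable_nat_add_iff k).2 hbsum).tsum_eq_zero_add, zero_add]
    congr 2
    ext j
    congr 1
    ring
  have hT0 : ∀ k, 0 ≤ T k := fun k => tsum_nonneg fun j => hb _
  have hTlim : Tendsto T atTop (𝓝 0) := tendsto_sum_nat_add b
  have hintb : ∀ k, Integrable (fun ω => (1 - c * a k) * V k ω + b k) P := fun k =>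
    ((hint k).const_mul _).add (integrable_const _)
  have hintT : ∀ k, Integrable (fun ω => V k ω + T k) P := fun k =>
    (hint k).add (integrable_const _)
  have hsuper : Supermartingale (fun k ω => V k ω + T k) ℱ P := by
    refine supermartingale_of_setIntegral_succ_le (fun k => (hadp k).add stronglyMeasurable_const)
      hintT fun k S hS => ?_
    rw [integral_add (hint _).integrableOn (integrable_const _)]
    calc _ ≤ ∫ ω in S, ((1 - c * a k) * V k ω + b k) ∂P + ∫ _ in S, T (k + 1) ∂P :=
          add_le_add (h k S hS) le_rfl
      _ = ∫ ω in S, ((1 - c * a k) * V k ω + b k + T (k + 1)) ∂P := by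
        rw [← integral_add (hintb k).integrableOn (integrable_const _)]
      _ ≤ _ := by
        refine integral_mono ((hintb k).add (integrable_const _)).integrableOn
          (hintT k).integrableOn fun ω => ?_
        have := mul_nonneg (mul_nonneg hc.le (ha k)) (hV k ω)
        simp only
        linarith [hTsucc k]
  -- Martingale convergence only yields some limit. The means satisfy the deterministic recursion
  -- and tend to zero, and Fatou's lemma then forces the limit to vanish.
  have hv := tendsto_zero_of_recursive_le (v := fun k => ∫ ω, V k ω ∂P) hc
    (fun k => integral_nonneg (hV k)) ha hasum hb hbsum fun k => by
      have := h k Set.univ MeasurableSet.univ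
      simp only [Measure.restrict_univ] at this
      rwa [integral_add ((hint k).const_mul _) (integrable_const _), integral_const_mul,
        integral_const, probReal_univ, one_smul] at this
  have hbound : ∀ k, eLpNorm (-fun ω => V k ω + T k) 1 P ≤
      ((∫ ω, (V 0 ω + T 0) ∂P).toNNReal : ℝ≥0∞) := by
    intro k
    rw [eLpNorm_neg, eLpNorm_one_eq_lintegral_enorm]
    have h1 : ∀ ω, ‖V k ω + T k‖ₑ = ENNReal.ofReal (V k ω + T k) := fun ω =>
      Real.enorm_of_nonneg (add_nonneg (hV k ω) (hT0 k))
    simp_rw [h1]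
    rw [← ofReal_integral_eq_lintegral_ofReal (hintT k)
      (ae_of_all _ fun ω => add_nonneg (hV k ω) (hT0 k))]
    refine ENNReal.ofReal_le_ofReal ?_
    have := hsuper.setIntegral_le (Nat.zero_le k) (MeasurableSet.univ (m := ℱ 0))
    simpa using this
  have hconv := hsuper.neg.exists_ae_tendsto_of_bdd hbound
  have hlint : Tendsto (fun k => ∫⁻ ω, ENNReal.ofReal (V k ω) ∂P) atTop (𝓝 0) := by
    have := ENNReal.tendsto_ofReal hv
    rw [ENNReal.ofReal_zero] at this
    refine this.congr fun k => ?_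
    exact ofReal_integral_eq_lintegral_ofReal (hint k) (ae_of_all _ (hV k))
  have hmeas : ∀ k, Measurable fun ω => ENNReal.ofReal (V k ω) := fun k =>
    ((hadp k).measurable.mono (ℱ.le k) le_rfl).ennreal_ofReal
  have hfatou : ∫⁻ ω, liminf (fun k => ENNReal.ofReal (V k ω)) atTop ∂P = 0 := by
    refine le_antisymm ?_ zero_le
    calc _ ≤ liminf (fun k => ∫⁻ ω, ENNReal.ofReal (V k ω) ∂P) atTop := lintegral_liminf_le hmeas
      _ = 0 := hlint.liminf_eq
  rw [lintegral_eq_zero_iff (Measurable.liminf hmeas)] at hfatou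
  filter_upwards [hconv, hfatou] with ω ⟨l, hl⟩ h0
  have hVl : Tendsto (fun k => V k ω) atTop (𝓝 (-l)) := by
    have := hl.neg.sub hTlim
    simpa using this
  have h1 := (ENNReal.tendsto_ofReal hVl).liminf_eq
  rw [h1] at h0
  have h2 : -l ≤ 0 := by simpa using h0
  have h3 : 0 ≤ -l := ge_of_tendsto' hVl fun k => hV k ω
  rwa [le_antisymm h2 h3] at hVl

end AlmostSupermartingale

/-! ### Convergence while the noise stays below the truncation level. -/

section Convergence

variable {Ω E : Type*} {m0 : MeasurableSpace Ω} [NormedAddCommGroup E]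

/-- The event that the initial distance to `xstar` is at most `R` and the first `k` noise vectors
stay below the truncation level. -/
def truncationEvent (a : ℕ → ℝ) (xstar : E) (x w : ℕ → Ω → E) (R : ℝ) (k : ℕ) : Set Ω :=
  {ω | ‖x 0 ω - xstar‖ ≤ R ∧ ∀ j < k, a j * ‖w j ω‖ ≤ 1 + ‖x j ω - xstar‖}

theorem truncationEvent_succ (a : ℕ → ℝ) (xstar : E) (x w : ℕ → Ω → E) (R : ℝ) (k : ℕ) :
    truncationEvent a xstar x w R (k + 1) =
      truncationEvent a xstar x w R k ∩ {ω | a k * ‖w k ω‖ ≤ 1 + ‖x k ω - xstar‖} := by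
  ext ω
  simp only [truncationEvent, Set.mem_ofPred_eq, Set.mem_inter_iff, Nat.lt_succ_iff_lt_or_eq]
  constructor
  · rintro ⟨h0, h⟩
    exact ⟨⟨h0, fun j hj => h j (Or.inl hj)⟩, h k (Or.inr rfl)⟩
  · rintro ⟨⟨h0, h⟩, hk⟩
    refine ⟨h0, ?_⟩
    rintro j (hj | rfl)
    exacts [h j hj, hk]

/-- Only noise with index `j < k` enters, and `w j` is known at time `j + 1`; hence the event
belongs to the past of step `k`. -/
theorem measurableSet_truncationEvent [MeasurableSpace E] [BorelSpace E] {ℱ : Filtration ℕ m0} {a : ℕ → ℝ} {xstar : E}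
    {x w : ℕ → Ω → E} (hx : ∀ k, Measurable[ℱ k] (x k)) (hw : ∀ k, Measurable[ℱ (k + 1)] (w k))
    (R : ℝ) (k : ℕ) : MeasurableSet[ℱ k] (truncationEvent a xstar x w R k) := by
  have hn : ∀ k, Measurable[ℱ k] fun ω => ‖x k ω - xstar‖ := fun k =>
    (continuous_id.sub continuous_const).norm.measurable.comp (hx k)
  induction k with
  | zero =>
    have : truncationEvent a xstar x w R 0 = (fun ω => ‖x 0 ω - xstar‖) ⁻¹' Set.Iic R := by
      ext ω
      simp [truncationEvent]
    rw [this]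
    exact hn 0 measurableSet_Iic
  | succ k ih =>
    rw [truncationEvent_succ]
    refine MeasurableSet.inter (ℱ.mono k.le_succ _ ih) ?_
    exact measurableSet_le (mδ := ℱ (k + 1))
      ((continuous_const.mul continuous_norm).measurable.comp (hw k))
      ((continuous_const.add continuous_id).measurable.comp
        ((hn k).mono (ℱ.mono k.le_succ) le_rfl))

variable {P : Measure[m0] Ω} [IsProbabilityMeasure P] [InnerProductSpace ℝ E] [CompleteSpace E]
  [MeasurableSpace E] [BorelSpace E] [ProperSpace E]

/-- SGD with small steps converges almost surely on the event that the noise never exceeds the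
truncation level. -/
theorem exists_ae_tendsto_of_forall_truncated {f : E → ℝ} {L : ℝ≥0} (hf : Differentiable ℝ f)
    (hg : LipschitzWith L (gradient f)) {fstar μ : ℝ} (hlb : ∀ x, fstar ≤ f x) (hμ : 0 < μ)
    (hPL : ∀ x, μ * (f x - fstar) ≤ ‖gradient f x‖ ^ 2 / 2) {xstar : E}
    (hmin : f xstar = fstar) (hgrad : gradient f xstar = 0) {c : ℝ} (hc : 0 < c)
    (hgrow : ∀ x, c * ‖x - xstar‖ ^ 2 ≤ f x - fstar) {p A B : ℝ} (hp : 1 < p) (hA : 0 ≤ A)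
    (hB : 0 ≤ B) : ∃ δ : ℝ, 0 < δ ∧ ∀ (ℱ : Filtration ℕ m0) (a : ℕ → ℝ) (x w : ℕ → Ω → E),
      (∀ k, 0 < a k) → (∀ k, a k ≤ δ) → (∀ k, a k ^ (p - 1) ≤ δ) → ¬ Summable a →
      Summable (fun k => a k ^ p) → (∀ k, Measurable[ℱ k] (x k)) →
      (∀ k, Measurable[ℱ (k + 1)] (w k)) → (∀ k, Integrable (w k) P) →
      (∀ k, P[w k | ℱ k] =ᵐ[P] 0) →
      (∀ k, P⁻[fun ω => ‖w k ω‖ₑ ^ p | ℱ k] ≤ᵐ[P]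
        (fun ω => ENNReal.ofReal (A + B * ‖x k ω - xstar‖ ^ p))) →
      (∀ k ω, x (k + 1) ω = x k ω + a k • (-gradient f (x k ω) + w k ω)) →
      ∀ᵐ ω ∂P, (∀ k, a k * ‖w k ω‖ ≤ 1 + ‖x k ω - xstar‖) →
        Tendsto (fun k => x k ω) atTop (𝓝 xstar) := by
  obtain ⟨n, δ, C, hδ, hC, hone⟩ := exists_setIntegral_step_le (P := P) hf hg hlb hμ hPL hmin hgrad
    hc hgrow hp hA hB
  refine ⟨δ, hδ, ?_⟩
  intro ℱ a x w ha haδ hapδ hasum hapsum hx hw hwi hw0 hwp hstep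
  have hfc : Continuous f := hf.continuous
  set g : E → ℝ := fun y => (f y - fstar) ^ (n + 2) with hg'
  have hgc : Continuous g := (hfc.sub continuous_const).pow _
  have hg0 : ∀ y, 0 ≤ g y := fun y => pow_nonneg (sub_nonneg.2 (hlb y)) _
  -- Truncated noise moves the iterate by at most `1 + ‖x k - xstar‖`, so a deterministic bound,
  -- depending on `k`, propagates. It serves only to secure integrability.
  have hbdd : ∀ R k, ∃ R', ∀ ω ∈ truncationEvent a xstar x w R k, ‖x k ω - xstar‖ ≤ R' := by
    intro R k
    induction k with
    | zero => exact ⟨R, fun ω hω => hω.1⟩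
    | succ k ih =>
      obtain ⟨R', hR'⟩ := ih
      refine ⟨R' + a k * (L * R') + (1 + R'), fun ω hω => ?_⟩
      rw [truncationEvent_succ] at hω
      have h1 := hR' ω hω.1
      have h2 : a k * ‖w k ω‖ ≤ 1 + ‖x k ω - xstar‖ := hω.2
      have h3 : ‖gradient f (x k ω)‖ ≤ L * ‖x k ω - xstar‖ := by
        have := hg.dist_le_mul (x k ω) xstar
        rwa [hgrad, dist_zero_right, dist_eq_norm] at this
      have e : x (k + 1) ω - xstar =
          (x k ω - xstar) + -(a k • gradient f (x k ω)) + a k • w k ω := by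
        rw [hstep, smul_add, smul_neg]; abel
      rw [e]
      refine (norm_add₃_le).trans ?_
      rw [norm_neg, norm_smul, norm_smul, Real.norm_eq_abs, abs_of_pos (ha k)]
      have h4 : a k * ‖gradient f (x k ω)‖ ≤ a k * (L * R') := by
        have := ha k
        gcongr
        exact h3.trans (by gcongr)
      linarith
  have key : ∀ R : ℕ, ∀ᵐ ω ∂P, Tendsto
      (fun k => (truncationEvent a xstar x w R k).indicator (fun ω => g (x k ω)) ω)
      atTop (𝓝 0) := by
    intro R
    have hE := measurableSet_truncationEvent (a := a) (xstar := xstar) hx hw R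
    have hgi : ∀ k, IntegrableOn (fun ω => g (x k ω)) (truncationEvent a xstar x w R k) P := by
      intro k
      obtain ⟨R', hR'⟩ := hbdd R k
      obtain ⟨κ, hκ⟩ := (isCompact_closedBall xstar R').exists_bound_of_continuousOn
        hgc.continuousOn
      exact integrableOn_of_abs_le (ℱ.le k) (hE k)
        (hgc.measurable.comp ((hx k).mono (ℱ.le k) le_rfl)) (κ := κ) fun ω hω =>
          hκ _ (by rw [mem_closedBall_iff_norm]; exact hR' ω hω)
    have hint : ∀ k, Integrable
        ((truncationEvent a xstar x w R k).indicator fun ω => g (x k ω)) P :=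
      fun k => (hgi k).integrable_indicator (ℱ.le k _ (hE k))
    refine ae_tendsto_zero_of_setIntegral_le (ℱ := ℱ) (a := a) (b := fun k => C * a k ^ p)
      (c := μ / 2) (by positivity)
      (fun k => ((hgc.measurable.comp (hx k)).stronglyMeasurable.indicator (hE k))) hint
      (fun k ω => Set.indicator_nonneg (fun _ _ => hg0 _) _) (fun k => (ha k).le) hasum
      (fun k => mul_nonneg hC (Real.rpow_nonneg (ha k).le _)) (hapsum.mul_left C) ?_
    intro k S hS
    obtain ⟨R', hR'⟩ := hbdd R k
    set Ek := truncationEvent a xstar x w R k with hEk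
    have hEk' : MeasurableSet[m0] Ek := ℱ.le k _ (hE k)
    have hap : 0 ≤ C * a k ^ p := mul_nonneg hC (Real.rpow_nonneg (ha k).le _)
    obtain ⟨-, h2⟩ := hone (ℱ k) (a k) R' (x k) (w k) (x (k + 1)) (S ∩ Ek) (ha k) (haδ k)
      (hapδ k) (ℱ.le k) (hx k) ((hw k).mono (ℱ.le _) le_rfl) (hwi k) (hw0 k) (hwp k) (hstep k)
      (hS.inter (hE k)) fun ω hω => hR' ω hω.2
    -- Passing to the next event multiplies by the indicator of one more truncation, which is
    -- exactly the truncated quantity of the one-step estimate.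
    have e1 : (truncationEvent a xstar x w R (k + 1)).indicator (fun ω => g (x (k + 1) ω)) =
        Ek.indicator fun ω => if a k * ‖w k ω‖ ≤ 1 + ‖x k ω - xstar‖ then
          (f (x (k + 1) ω) - fstar) ^ (n + 2) else 0 := by
      rw [truncationEvent_succ]
      ext ω
      by_cases h1 : ω ∈ Ek <;> by_cases h2 : a k * ‖w k ω‖ ≤ 1 + ‖x k ω - xstar‖ <;>
        simp [h1, h2, hg', ← hEk, Set.indicator]
    calc ∫ ω in S, (truncationEvent a xstar x w R (k + 1)).indicator
          (fun ω => g (x (k + 1) ω)) ω ∂P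
        = ∫ ω in S ∩ Ek, (if a k * ‖w k ω‖ ≤ 1 + ‖x k ω - xstar‖ then
          (f (x (k + 1) ω) - fstar) ^ (n + 2) else 0) ∂P := by
          rw [e1, setIntegral_indicator hEk']
      _ ≤ ∫ ω in S ∩ Ek, ((1 - μ / 2 * a k) * (f (x k ω) - fstar) ^ (n + 2) + C * a k ^ p) ∂P := h2
      _ = ∫ ω in S, Ek.indicator (fun ω => (1 - μ / 2 * a k) * g (x k ω) + C * a k ^ p) ω ∂P := by
          rw [setIntegral_indicator hEk']
      _ ≤ ∫ ω in S, ((1 - μ / 2 * a k) * Ek.indicator (fun ω => g (x k ω)) ω + C * a k ^ p) ∂P := by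
          refine integral_mono ?_ ?_ fun ω => ?_
          · refine (IntegrableOn.integrable_indicator ?_ hEk').integrableOn
            exact ((hgi k).const_mul _).add (integrable_const _)
          · exact (((hint k).const_mul _).add (integrable_const _)).integrableOn
          · by_cases h : ω ∈ Ek <;> simp [h, hap]
  -- If the level is never exceeded, `ω` lies in all events for any integer `R ≥ ‖x 0 ω - xstar‖`,
  -- so the indicators disappear; quadratic growth turns `g → 0` into convergence of the iterates.
  filter_upwards [ae_all_iff.2 key] with ω hω htr
  obtain ⟨R, hR⟩ := exists_nat_ge ‖x 0 ω - xstar‖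
  have h1 : Tendsto (fun k => g (x k ω)) atTop (𝓝 0) := by
    refine (hω R).congr fun k => ?_
    rw [Set.indicator_of_mem]
    exact ⟨hR, fun j _ => htr j⟩
  rw [Metric.tendsto_atTop]
  intro ε hε
  have h2 : 0 < (c * ε ^ 2) ^ (n + 2) := by positivity
  obtain ⟨N, hN⟩ := Filter.eventually_atTop.1 (h1.eventually_lt_const h2)
  refine ⟨N, fun k hk => ?_⟩
  have h3 : f (x k ω) - fstar < c * ε ^ 2 :=
    lt_of_pow_lt_pow_left₀ (n + 2) (by positivity) (hN k hk)
  have h4 := (hgrow (x k ω)).trans_lt h3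
  rw [dist_eq_norm]
  exact lt_of_pow_lt_pow_left₀ 2 hε.le ((mul_lt_mul_iff_right₀ hc).1 h4)

end Convergence

/-! ### Summability and bounds for the step sizes. -/

section StepSize

theorem stepSize_pos {α K : ℝ} (hα : 0 < α) (hK : 0 < K) (ξ : ℝ) (k : ℕ) :
    0 < stepSize α K ξ k := by
  unfold stepSize
  positivity

theorem summable_stepSize_rpow_iff {α K : ℝ} (hα : 0 < α) (hK : 0 < K) (ξ p : ℝ) :
    Summable (fun k => stepSize α K ξ k ^ p) ↔ 1 < ξ * p := by
  rw [← Real.summable_one_div_nat_add_rpow K (ξ * p)]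
  refine Iff.trans ?_ (summable_mul_left_iff (a := α ^ p) (by positivity))
  refine summable_congr fun k => ?_
  have h : 0 < (k : ℝ) + K := by positivity
  rw [stepSize, Real.mul_rpow hα.le (by positivity), ← Real.rpow_mul h.le, abs_of_pos h, one_div,
    ← Real.rpow_neg h.le, neg_mul]

theorem summable_stepSize_iff {α K : ℝ} (hα : 0 < α) (hK : 0 < K) (ξ : ℝ) :
    Summable (stepSize α K ξ) ↔ 1 < ξ := by
  simpa using summable_stepSize_rpow_iff hα hK ξ 1

theorem tendsto_stepSize_zero (α K : ℝ) {ξ : ℝ} (hξ : 0 < ξ) :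
    Tendsto (stepSize α K ξ) atTop (𝓝 0) := by
  have h : Tendsto (fun k : ℕ => (k : ℝ) + K) atTop atTop :=
    tendsto_atTop_add_const_right _ _ tendsto_natCast_atTop_atTop
  have h2 := ((tendsto_rpow_neg_atTop hξ).comp h).const_mul α
  rwa [mul_zero] at h2

theorem stepSize_le_of_nonneg {α K ξ : ℝ} (hα : 0 < α) (hK : 0 < K) (hξ : 0 ≤ ξ) (k : ℕ) :
    stepSize α K ξ k ≤ α * K ^ (-ξ) := by
  have : (0 : ℝ) ≤ k := k.cast_nonneg
  unfold stepSize
  gcongr ?_ * ?_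
  exact Real.rpow_le_rpow_of_nonpos hK (by linarith) (by linarith)

theorem le_stepSize_of_nonpos {α K ξ : ℝ} (hα : 0 < α) (hK : 0 < K) (hξ : ξ ≤ 0) (k : ℕ) :
    α * K ^ (-ξ) ≤ stepSize α K ξ k := by
  have : (0 : ℝ) ≤ k := k.cast_nonneg
  unfold stepSize
  gcongr ?_ * ?_
  exact Real.rpow_le_rpow hK.le (by linarith) (by linarith)

end StepSize

/-! ### Convergence for `1 / p < ξ ≤ 1`. -/

section Sufficiency

variable {Ω : Type*} [m0 : MeasurableSpace Ω] {d : ℕ}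

/-- The filtration of the past iterates. -/
def iterateFiltration {x : ℕ → Ω → EuclideanSpace ℝ (Fin d)} (hx : ∀ k, Measurable (x k)) :
    Filtration ℕ m0 where
  seq := iterateHistory x
  mono' _ _ hij := biSup_mono fun _ h => h.trans hij
  le' _ := iSup₂_le fun j _ => (hx j).comap_le

/-- SGD with unbiased noise of bounded conditional `p`-th moment converges almost surely if
`1 / p < ξ ≤ 1`. -/
theorem ae_tendsto_of_isSGD {f : EuclideanSpace ℝ (Fin d) → ℝ} {L : ℝ≥0}
    (hsmooth : IsSmoothWith L f) {fstar : ℝ} (hPL : SatisfiesPL f fstar)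
    {xstar : EuclideanSpace ℝ (Fin d)} (hxstar : ∀ x, gradient f x = 0 ↔ x = xstar)
    {p A B : ℝ} (hp : 1 < p) (hA : 0 ≤ A) (hB : 0 ≤ B) {α K ξ : ℝ} (hα : 0 < α) (hK : 0 < K)
    (hξ : ξ ∈ Set.Ioc (1 / p) 1) {P : Measure Ω} [IsProbabilityMeasure P]
    {x w : ℕ → Ω → EuclideanSpace ℝ (Fin d)} (hsgd : IsSGD f (stepSize α K ξ) x w)
    (hunb : IsUnbiasedNoise P x w) (hmom : HasMomentBound P p A B xstar x w) :
    ∀ᵐ ω ∂P, Tendsto (fun k => x k ω) atTop (𝓝 xstar) := by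
  obtain ⟨hf, hg⟩ := hsmooth
  obtain ⟨hglb, μ, hμ, hPL⟩ := hPL
  have hlb : ∀ x, fstar ≤ f x := fun x => hglb.1 ⟨x, rfl⟩
  obtain ⟨hmin, c, hc, hgrow⟩ := exists_quadratic_growth hf hg hlb hμ hPL fun x => (hxstar x).1
  obtain ⟨δ, hδ, hmain⟩ := exists_ae_tendsto_of_forall_truncated (P := P) hf hg hlb hμ hPL hmin
    ((hxstar xstar).2 rfl) hc hgrow hp hA hB
  set a := stepSize α K ξ with ha
  have hp0 : 0 < p := by linarith
  have hξ0 : 0 < ξ := lt_trans (by positivity) hξ.1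
  have hapos : ∀ k, 0 < a k := stepSize_pos hα hK ξ
  have halim : Tendsto a atTop (𝓝 0) := tendsto_stepSize_zero α K hξ0
  have haplim : Tendsto (fun k => a k ^ (p - 1)) atTop (𝓝 0) := by
    have := halim.rpow_const (p := p - 1) (Or.inr (by linarith))
    rwa [Real.zero_rpow (by linarith)] at this
  have hasum : ¬ Summable a := by
    rw [ha, summable_stepSize_iff hα hK]
    exact not_lt.2 hξ.2
  have hapsum : Summable fun k => a k ^ p := by
    rw [ha, summable_stepSize_rpow_iff hα hK]
    exact (div_lt_iff₀ hp0).1 hξ.1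
  set ℱ := iterateFiltration hsgd.measurable_iterate with hℱ
  have hx : ∀ k, Measurable[ℱ k] (x k) := fun k =>
    Measurable.of_comap_le (le_iSup₂ (f := fun j (_ : j ≤ k) =>
      MeasurableSpace.comap (x j) inferInstance) k le_rfl)
  -- Because `a k ≠ 0`, the noise can be recovered from two consecutive iterates.
  have hw : ∀ k, Measurable[ℱ (k + 1)] (w k) := by
    intro k
    have e : w k = fun ω => (a k)⁻¹ • (x (k + 1) ω - x k ω) + gradient f (x k ω) := by
      ext1 ω
      rw [hsgd.step, add_sub_cancel_left, smul_smul, inv_mul_cancel₀ (hapos k).ne', one_smul]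
      abel
    have hxk : Measurable[ℱ (k + 1)] (x k) := (hx k).mono (ℱ.mono k.le_succ) le_rfl
    rw [e]
    exact ((continuous_const_smul (a k)⁻¹).measurable.comp ((hx (k + 1)).sub hxk)).add
      (hg.continuous.measurable.comp hxk)
  obtain ⟨n₀, hn₀⟩ := eventually_atTop.1
    ((halim.eventually_le_const hδ).and (haplim.eventually_le_const hδ))
  -- The run is restarted at every time `n ≥ n₀`, where the steps are small. No integrability of `x
  -- n` is needed, and countably many null sets allow `n` to depend on `ω` afterwards.
  have hshift : ∀ n, n₀ ≤ n → ∀ᵐ ω ∂P,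
      (∀ k, a (n + k) * ‖w (n + k) ω‖ ≤ 1 + ‖x (n + k) ω - xstar‖) →
        Tendsto (fun k => x (n + k) ω) atTop (𝓝 xstar) := by
    intro n hn
    let 𝒢 : Filtration ℕ m0 := ⟨fun k => ℱ (n + k), fun i j h => ℱ.mono (by omega), fun k => ℱ.le _⟩
    refine hmain 𝒢 (fun k => a (n + k)) (fun k => x (n + k)) (fun k => w (n + k))
      (fun k => hapos _) (fun k => (hn₀ _ (by omega)).1) (fun k => (hn₀ _ (by omega)).2) ?_ ?_
      (fun k => hx _) (fun k => hw _) (fun k => (hunb _).1) (fun k => (hunb _).2)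
      (fun k => hmom _) (fun k ω => hsgd.step _ ω)
    · simp_rw [add_comm n]
      rwa [summable_nat_add_iff]
    · simp_rw [add_comm n]
      exact (summable_nat_add_iff (f := fun k => a k ^ p) n).2 hapsum
  have hBC : ∀ᵐ ω ∂P, ∀ᶠ k in atTop, ¬ (1 + ‖x k ω - xstar‖ < a k * ‖w k ω‖) := by
    refine ae_eventually_notMem (s := fun k => {ω | 1 + ‖x k ω - xstar‖ < a k * ‖w k ω‖}) ?_
    refine ne_top_of_le_ne_top ?_ (ENNReal.tsum_le_tsum fun k =>
      measure_lt_mul_norm_le hp0.le hA hB (ℱ.le k) (hx k) (hsgd.measurable_noise k) (hmom k)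
        (hapos k).le)
    exact (hapsum.mul_left (A + B)).tsum_ofReal_ne_top
  filter_upwards [hBC, ae_all_iff.2 fun n => eventually_imp_distrib_left.2 (hshift n)] with ω h1 h2
  obtain ⟨n₁, hn₁⟩ := eventually_atTop.1 h1
  have h3 := h2 (max n₀ n₁) (le_max_left _ _) fun k => not_lt.1 (hn₁ _ (by omega))
  simp_rw [add_comm (max n₀ n₁)] at h3
  exact (tendsto_add_atTop_iff_nat (f := fun k => x k ω) _).1 h3

end Sufficiency

/-! ### Independent symmetric noise variables. -/

section Noise

/-- The law of a random variable equal to `b` and `-b` with probability `q / 2` each, and to `0`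
otherwise. -/
noncomputable def symmetricLaw (b q : ℝ) : Measure ℝ :=
  ENNReal.ofReal (q / 2) • Measure.dirac b + ENNReal.ofReal (q / 2) • Measure.dirac (-b) +
    ENNReal.ofReal (1 - q) • Measure.dirac 0

theorem lintegral_symmetricLaw (b q : ℝ) (g : ℝ → ℝ≥0∞) :
    ∫⁻ t, g t ∂symmetricLaw b q = ENNReal.ofReal (q / 2) * g b + ENNReal.ofReal (q / 2) * g (-b) +
      ENNReal.ofReal (1 - q) * g 0 := by
  simp [symmetricLaw, lintegral_add_measure, lintegral_smul_measure]

theorem ofReal_half_add_half {q : ℝ} (hq : 0 ≤ q) :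
    ENNReal.ofReal (q / 2) + ENNReal.ofReal (q / 2) = ENNReal.ofReal q := by
  rw [← ENNReal.ofReal_add (by positivity) (by positivity), add_halves]

theorem isProbabilityMeasure_symmetricLaw (b : ℝ) {q : ℝ} (hq0 : 0 ≤ q) (hq1 : q ≤ 1) :
    IsProbabilityMeasure (symmetricLaw b q) := by
  constructor
  rw [← lintegral_one, lintegral_symmetricLaw]
  simp only [mul_one]
  rw [ofReal_half_add_half hq0, ← ENNReal.ofReal_add hq0 (by linarith)]
  simp

theorem integral_symmetricLaw_id (b q : ℝ) : ∫ t, t ∂symmetricLaw b q = 0 := by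
  have h : ∀ (c : ℝ) (t : ℝ), Integrable (fun t : ℝ => t) (ENNReal.ofReal c • Measure.dirac t) :=
    fun c t => (integrable_dirac (by simp)).smul_measure ENNReal.ofReal_ne_top
  rw [symmetricLaw, integral_add_measure ((h _ _).add_measure (h _ _)) (h _ _),
    integral_add_measure (h _ _) (h _ _), integral_smul_measure, integral_smul_measure,
    integral_smul_measure, integral_dirac, integral_dirac, integral_dirac]
  simp

/-- The real values are lifted by `ULift` so that the sample space lies in the universe `u` over
which the runs are quantified. -/
theorem exists_iIndepFun_symmetricLaw (b q : ℕ → ℝ) (hq0 : ∀ k, 0 ≤ q k) (hq1 : ∀ k, q k ≤ 1) :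
    ∃ (Ω : Type u) (_ : MeasurableSpace Ω) (P : Measure Ω) (r : ℕ → Ω → ℝ),
      IsProbabilityMeasure P ∧ (∀ k, Measurable (r k)) ∧
        (∀ k, P.map (r k) = symmetricLaw (b k) (q k)) ∧ iIndepFun r P := by
  have := fun k => isProbabilityMeasure_symmetricLaw (b k) (hq0 k) (hq1 k)
  have : ∀ k, IsProbabilityMeasure
      ((symmetricLaw (b k) (q k)).map (ULift.up.{u} : ℝ → ULift.{u} ℝ)) :=
    fun k => Measure.isProbabilityMeasure_map measurable_up.aemeasurable
  obtain ⟨Ω, mΩ, P, X, hX, hlaw, hind, hP⟩ := exists_hasLaw_indepFun (fun _ : ℕ => ULift.{u} ℝ)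
    fun k => (symmetricLaw (b k) (q k)).map ULift.up
  refine ⟨Ω, mΩ, P, fun k ω => (X k ω).down, hP, fun k => measurable_down.comp (hX k), fun k => ?_,
    hind.comp (fun _ => ULift.down) fun _ => measurable_down⟩
  have h := (hlaw k).map_eq
  change P.map (ULift.down ∘ X k) = _
  rw [← Measure.map_map measurable_down (hX k), h, Measure.map_map measurable_down measurable_up]
  exact Measure.map_id

end Noise

/-! ### Conditional expectation under independence. -/

section Conditional

variable {Ω : Type*} {m₁ m₂ m0 : MeasurableSpace Ω} {P : Measure[m0] Ω} [IsProbabilityMeasure P]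

theorem condLExp_indep_eq (h₁ : m₁ ≤ m0) (h₂ : m₂ ≤ m0) {X : Ω → ℝ≥0∞} (hX : Measurable[m₁] X)
    (hind : Indep m₁ m₂ P) : P⁻[X | m₂] =ᵐ[P] fun _ => ∫⁻ ω, X ω ∂P := by
  refine (ae_eq_condLExp h₂ P X measurable_const fun s hs => ?_).symm
  have h := lintegral_mul_eq_lintegral_mul_lintegral_of_independent_measurableSpace h₁ h₂ hind hX
    ((measurable_const (a := (1 : ℝ≥0∞))).indicator hs)
  have e : (fun ω => X ω * s.indicator (fun _ => 1) ω) = s.indicator X := by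
    ext ω
    by_cases hω : ω ∈ s <;> simp [hω]
  rw [e, lintegral_indicator (h₂ s hs), lintegral_indicator (h₂ s hs)] at h
  rw [h]
  simp

end Conditional

/-! ### SGD runs driven by independent noise. -/

section IndependentNoise

variable {Ω : Type u} [m0 : MeasurableSpace Ω] {d : ℕ}

/-- The iterates of SGD started at `x₀` with noise `r k • v`. -/
noncomputable def sgdIterates (f : EuclideanSpace ℝ (Fin d) → ℝ) (a : ℕ → ℝ)
    (x₀ v : EuclideanSpace ℝ (Fin d)) (r : ℕ → Ω → ℝ) : ℕ → Ω → EuclideanSpace ℝ (Fin d)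
  | 0, _ => x₀
  | k + 1, ω => sgdIterates f a x₀ v r k ω +
      a k • (-gradient f (sgdIterates f a x₀ v r k ω) + r k ω • v)

variable {f : EuclideanSpace ℝ (Fin d) → ℝ} {a : ℕ → ℝ} {x₀ v : EuclideanSpace ℝ (Fin d)}
  {r : ℕ → Ω → ℝ}

omit m0 in
theorem measurable_sgdIterates (hg : Continuous (gradient f)) {m : MeasurableSpace Ω} {k : ℕ}
    (hr : ∀ j < k, Measurable (r j)) : Measurable (sgdIterates f a x₀ v r k) := by
  induction k with
  | zero => exact measurable_const
  | succ k ih =>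
    have h := ih fun j hj => hr j (by omega)
    have h2 := hr k k.lt_succ_self
    exact h.add (((hg.measurable.comp h).neg.add (h2.smul_const v)).const_smul (a k))

/-- The σ-algebra generated by the first `k` noise variables. -/
abbrev noiseHistory (r : ℕ → Ω → ℝ) (k : ℕ) : MeasurableSpace Ω :=
  ⨆ j ∈ Set.Iio k, MeasurableSpace.comap (r j) inferInstance

omit m0 in
theorem measurable_noiseHistory {k j : ℕ} (hj : j < k) : Measurable[noiseHistory r k] (r j) :=
  Measurable.of_comap_le (le_iSup₂ (f := fun j (_ : j ∈ Set.Iio k) =>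
    MeasurableSpace.comap (r j) inferInstance) j hj)

omit m0 in
-- With a deterministic start, `x k` is a function of the noise with indices below `k`. Hence `r k`
-- is independent of the iterate history, and conditional moments become plain moments.
theorem iterateHistory_le_noiseHistory (hg : Continuous (gradient f)) (k : ℕ) :
    iterateHistory (sgdIterates f a x₀ v r) k ≤ noiseHistory r k :=
  iSup₂_le fun j hj => (measurable_sgdIterates (m := noiseHistory r k) hg fun i hi =>
    measurable_noiseHistory (by omega)).comap_le

theorem indep_noise_noiseHistory {P : Measure Ω} (hr : ∀ k, Measurable (r k))
    (hind : iIndepFun r P) (k : ℕ) :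
    Indep (MeasurableSpace.comap (r k) inferInstance) (noiseHistory r k) P := by
  have h := indep_iSup_of_disjoint (fun i => (hr i).comap_le) ((iIndepFun_iff_iIndep _ _ _).1 hind)
    (S := {k}) (T := Set.Iio k) (by simp)
  rw [iSup_singleton] at h
  exact h

theorem isSGD_sgdIterates (hg : Continuous (gradient f)) (hr : ∀ k, Measurable (r k)) :
    IsSGD f a (sgdIterates f a x₀ v r) fun k ω => r k ω • v where
  measurable_iterate _ := measurable_sgdIterates hg fun j _ => hr j
  measurable_noise k := (hr k).smul_const v
  step _ _ := rfl

variable {P : Measure Ω} [IsProbabilityMeasure P] {b q : ℕ → ℝ}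

theorem isUnbiasedNoise_sgdIterates (hg : Continuous (gradient f)) (hr : ∀ k, Measurable (r k))
    (hlaw : ∀ k, P.map (r k) = symmetricLaw (b k) (q k)) (hind : iIndepFun r P) :
    IsUnbiasedNoise P (sgdIterates f a x₀ v r) fun k ω => r k ω • v := by
  intro k
  have hle := iterateHistory_le_noiseHistory (r := r) (a := a) (x₀ := x₀) (v := v) hg k
  have hint : Integrable (r k) P := by
    refine ⟨(hr k).aestronglyMeasurable, ?_⟩
    rw [hasFiniteIntegral_iff_enorm, ← lintegral_map (g := r k) measurable_enorm (hr k), hlaw,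
      lintegral_symmetricLaw]
    simp [ENNReal.mul_lt_top_iff]
  refine ⟨hint.smul_const v, ?_⟩
  have hm : iterateHistory (sgdIterates f a x₀ v r) k ≤ m0 :=
    hle.trans (iSup₂_le fun j _ => (hr j).comap_le)
  refine (condExp_indep_eq (hr k).comap_le hm (f := fun ω => r k ω • v) ?_
    (indep_of_indep_of_le_right (indep_noise_noiseHistory hr hind k) hle)).trans ?_
  · exact ((comap_measurable (r k)).smul_const v).stronglyMeasurable
  · have : ∫ ω, r k ω ∂P = 0 := by
      rw [← integral_symmetricLaw_id (b k) (q k), ← hlaw, integral_map (hr k).aemeasurable]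
      exact measurable_id.aestronglyMeasurable
    rw [integral_smul_const, this, zero_smul]
    rfl

theorem hasMomentBound_sgdIterates (hg : Continuous (gradient f)) (hr : ∀ k, Measurable (r k))
    (hlaw : ∀ k, P.map (r k) = symmetricLaw (b k) (q k)) (hind : iIndepFun r P) (hv : ‖v‖ = 1)
    {p A B : ℝ} (hp : 0 < p) (hB : 0 ≤ B) (hq : ∀ k, 0 ≤ q k) (hbq : ∀ k, q k * |b k| ^ p ≤ A)
    (xstar : EuclideanSpace ℝ (Fin d)) :
    HasMomentBound P p A B xstar (sgdIterates f a x₀ v r) fun k ω => r k ω • v := by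
  intro k
  have hle := iterateHistory_le_noiseHistory (r := r) (a := a) (x₀ := x₀) (v := v) hg k
  have hm : iterateHistory (sgdIterates f a x₀ v r) k ≤ m0 :=
    hle.trans (iSup₂_le fun j _ => (hr j).comap_le)
  have hve : ‖v‖ₑ = 1 := by rw [← ofReal_norm, hv, ENNReal.ofReal_one]
  have h := condLExp_indep_eq (P := P) (hr k).comap_le hm (X := fun ω => ‖r k ω • v‖ₑ ^ p)
    ((show Measurable fun t : ℝ => ‖t • v‖ₑ ^ p by fun_prop).comp (comap_measurable (r k)))
    (indep_of_indep_of_le_right (indep_noise_noiseHistory hr hind k) hle)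
  filter_upwards [h] with ω hω
  rw [hω]
  simp_rw [enorm_smul, hve, mul_one]
  rw [← lintegral_map (f := fun t : ℝ => ‖t‖ₑ ^ p) (g := r k) (measurable_enorm.pow_const p) (hr k),
    hlaw, lintegral_symmetricLaw, enorm_neg, enorm_zero, ENNReal.zero_rpow_of_pos hp, mul_zero,
    add_zero, ← add_mul, ofReal_half_add_half (hq k), Real.enorm_eq_ofReal_abs,
    ENNReal.ofReal_rpow_of_nonneg (abs_nonneg _) hp.le, ← ENNReal.ofReal_mul (hq k)]
  refine ENNReal.ofReal_le_ofReal ((hbq k).trans ?_)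
  have : 0 ≤ B * ‖sgdIterates f a x₀ v r k ω - xstar‖ ^ p := by positivity
  linarith

/-- A step with symmetric two-point noise of size `b` leaves the iterate at distance at least
`a * b` from any given point with probability at least one half. -/
theorem half_le_measure_le_norm_sub (hg : Continuous (gradient f)) (hr : ∀ k, Measurable (r k))
    (hlaw : ∀ k, P.map (r k) = symmetricLaw (b k) (q k)) (hind : iIndepFun r P) (hv : ‖v‖ = 1)
    {k : ℕ} (hqk : q k = 1) (xstar : EuclideanSpace ℝ (Fin d)) :
    2⁻¹ ≤ P {ω | a k * b k ≤ ‖sgdIterates f a x₀ v r (k + 1) ω - xstar‖} := by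
  set x := sgdIterates f a x₀ v r with hx
  set Y : Ω → EuclideanSpace ℝ (Fin d) := fun ω => x k ω - a k • gradient f (x k ω) - xstar with hY
  have hxm : Measurable[noiseHistory r k] (x k) := measurable_sgdIterates hg fun j hj =>
    measurable_noiseHistory hj
  have hYm : Measurable[noiseHistory r k] Y :=
    ((continuous_id.sub (hg.const_smul (a k))).sub continuous_const).measurable.comp hxm
  have hm : noiseHistory r k ≤ m0 := iSup₂_le fun j _ => (hr j).comap_le
  have hindY : IndepFun Y (r k) P := by
    rw [IndepFun_iff_Indep]
    exact (indep_of_indep_of_le_right (indep_noise_noiseHistory hr hind k) hYm.comap_le).symm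
  have hY0 : Measurable Y := hYm.mono hm le_rfl
  have hmap := (indepFun_iff_map_prod_eq_prod_map_map hY0.aemeasurable (hr k).aemeasurable).1 hindY
  set S : Set (EuclideanSpace ℝ (Fin d) × ℝ) := {z | a k * b k ≤ ‖z.1 + (a k * z.2) • v‖} with hS
  have hSm : MeasurableSet S := by
    refine measurableSet_le measurable_const (Continuous.measurable ?_)
    fun_prop
  have e : {ω | a k * b k ≤ ‖x (k + 1) ω - xstar‖} = (fun ω => (Y ω, r k ω)) ⁻¹' S := by
    ext ω
    have : x (k + 1) ω - xstar = Y ω + (a k * r k ω) • v := by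
      simp only [hx, sgdIterates, hY, smul_add, smul_neg, smul_smul]
      abel
    simp [hS, this]
  have : IsProbabilityMeasure (P.map (r k)) :=
    Measure.isProbabilityMeasure_map (hr k).aemeasurable
  have : IsProbabilityMeasure (P.map Y) := Measure.isProbabilityMeasure_map hY0.aemeasurable
  rw [e, ← Measure.map_apply (hY0.prodMk (hr k)) hSm, hmap, Measure.prod_apply hSm]
  -- By independence the past `y` may be frozen. The two outcomes `y ± (a k * b k) • v` differ by `2
  -- * (a k * b k)` in norm when this is nonnegative, so they cannot both be closer to the origin
  -- than `a k * b k`; each has probability one half.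
  have hpt : ∀ y, 2⁻¹ ≤ P.map (r k) (Prod.mk y ⁻¹' S) := by
    intro y
    have hsec : MeasurableSet (Prod.mk y ⁻¹' S) := measurable_prodMk_left hSm
    rw [← lintegral_indicator_one hsec, hlaw, lintegral_symmetricLaw, hqk]
    have hhalf : ENNReal.ofReal (1 / 2) = 2⁻¹ := by
      rw [one_div, ENNReal.ofReal_inv_of_pos two_pos, ENNReal.ofReal_ofNat]
    rw [hhalf]
    have hor : b k ∈ Prod.mk y ⁻¹' S ∨ -b k ∈ Prod.mk y ⁻¹' S := by
      by_contra! hcon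
      simp only [hS, Set.mem_preimage, Set.mem_ofPred_eq, not_le] at hcon
      have h1 := norm_sub_le (y + (a k * b k) • v) (y + (a k * -b k) • v)
      have h2 : y + (a k * b k) • v - (y + (a k * -b k) • v) = (2 * (a k * b k)) • v := by
        rw [add_sub_add_left_eq_sub, ← sub_smul]
        congr 1
        ring
      rw [h2, norm_smul, hv, mul_one, Real.norm_eq_abs] at h1
      linarith [le_abs_self (2 * (a k * b k)), hcon.1, hcon.2]
    rcases hor with h | h
    · rw [Set.indicator_of_mem h, Pi.one_apply, mul_one, add_assoc]
      exact le_self_add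
    · rw [Set.indicator_of_mem h (f := 1), Pi.one_apply, mul_one, add_right_comm]
      exact le_add_self
  calc (2⁻¹ : ℝ≥0∞) = ∫⁻ _, 2⁻¹ ∂P.map Y := by simp
    _ ≤ _ := lintegral_mono hpt

end IndependentNoise

/-! ### Divergent runs for all other exponents. -/

section Necessity

/-- Almost sure convergence is incompatible with staying away from the limit with probability at
least one half along a tail of the process. -/
theorem not_ae_tendsto_of_half_le_measure {Ω E : Type*} [MeasurableSpace Ω] {P : Measure Ω}
    [IsProbabilityMeasure P] [NormedAddCommGroup E] [MeasurableSpace E] [BorelSpace E]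
    [SecondCountableTopology E] {x : ℕ → Ω → E} {xstar : E} (hx : ∀ k, Measurable (x k)) {ε : ℝ}
    (hε : 0 < ε) {N : ℕ} (h : ∀ k ≥ N, 2⁻¹ ≤ P {ω | ε ≤ ‖x k ω - xstar‖}) :
    ¬ ∀ᵐ ω ∂P, Tendsto (fun k => x k ω) atTop (𝓝 xstar) := by
  intro hlim
  have hmeas := tendstoInMeasure_of_tendsto_ae (fun k => (hx k).aestronglyMeasurable) hlim
  rw [tendstoInMeasure_iff_norm] at hmeas
  have h2 := ge_of_tendsto (hmeas ε hε) (eventually_atTop.2 ⟨N, h⟩)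
  simp at h2

/-- A noiseless step cannot approach `xstar` too fast, since the gradient is at most `L * ‖x -
xstar‖`. -/
theorem mul_norm_le_norm_step {d : ℕ} {f : EuclideanSpace ℝ (Fin d) → ℝ} {L : ℝ≥0}
    (hg : LipschitzWith L (gradient f)) {xstar : EuclideanSpace ℝ (Fin d)}
    (hgrad : gradient f xstar = 0) {α : ℝ} (hα : 0 ≤ α) (x : EuclideanSpace ℝ (Fin d)) :
    (1 - α * L) * ‖x - xstar‖ ≤ ‖x - α • gradient f x - xstar‖ := by
  have h1 := hg.dist_le_mul x xstar
  rw [hgrad, dist_zero_right, dist_eq_norm] at h1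
  have h2 := norm_sub_norm_le (x - xstar) (α • gradient f x)
  rw [norm_smul, Real.norm_eq_abs, abs_of_nonneg hα] at h2
  rw [sub_right_comm]
  have h3 := mul_le_mul_of_nonneg_left h1 hα
  linarith

variable {d : ℕ} {f : EuclideanSpace ℝ (Fin d) → ℝ} {L : ℝ≥0} {p A B α K ξ : ℝ}
  {xstar : EuclideanSpace ℝ (Fin d)}

/-- Almost sure convergence of all admissible SGD runs with step sizes `a`. -/
def AllRunsConverge (f : EuclideanSpace ℝ (Fin d) → ℝ) (a : ℕ → ℝ) (p A B : ℝ)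
    (xstar : EuclideanSpace ℝ (Fin d)) : Prop :=
  ∀ (Ω : Type u) [MeasurableSpace Ω] (P : Measure Ω) [IsProbabilityMeasure P]
    (x w : ℕ → Ω → EuclideanSpace ℝ (Fin d)),
    IsSGD f a x w → IsUnbiasedNoise P x w → HasMomentBound P p A B xstar x w →
    ∀ᵐ ω ∂P, Tendsto (fun k => x k ω) atTop (𝓝 xstar)

theorem exists_norm_eq_one (hd : 0 < d) : ∃ v : EuclideanSpace ℝ (Fin d), ‖v‖ = 1 :=
  ⟨EuclideanSpace.single ⟨0, hd⟩ 1, by simp⟩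

/-- If the step sizes do not decrease, noise of constant size prevents convergence. -/
theorem not_allRunsConverge_of_neg (hd : 0 < d) (hg : LipschitzWith L (gradient f)) (hp : 1 < p)
    (hA : 0 < A) (hB : 0 ≤ B) (hα : 0 < α) (hK : 0 < K) (hξ : ξ < 0) :
    ¬ AllRunsConverge.{u} f (stepSize α K ξ) p A B xstar := by
  intro hall
  have hp0 : 0 < p := by linarith
  obtain ⟨v, hv⟩ := exists_norm_eq_one hd
  set b : ℝ := A ^ p⁻¹ with hb
  have hb0 : 0 < b := by positivity
  have hbp : b ^ p = A := Real.rpow_inv_rpow hA.le hp0.ne'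
  obtain ⟨Ω, mΩ, P, r, hP, hr, hlaw, hind⟩ := exists_iIndepFun_symmetricLaw.{u} (fun _ => b)
    (fun _ => 1) (fun _ => zero_le_one) fun _ => le_rfl
  have hgc := hg.continuous
  have hsgd := isSGD_sgdIterates (a := stepSize α K ξ) (x₀ := xstar) (v := v) hgc hr
  refine not_ae_tendsto_of_half_le_measure (P := P) (N := 1) (ε := α * K ^ (-ξ) * b)
    hsgd.measurable_iterate (by positivity) (fun k hk => ?_)
    (hall Ω P _ _ hsgd (isUnbiasedNoise_sgdIterates hgc hr hlaw hind)
      (hasMomentBound_sgdIterates hgc hr hlaw hind hv hp0 hB (fun _ => zero_le_one)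
        (fun _ => by rw [abs_of_pos hb0, hbp, one_mul]) xstar))
  obtain ⟨k, rfl⟩ := Nat.exists_eq_add_of_le' hk
  refine (half_le_measure_le_norm_sub (a := stepSize α K ξ) (x₀ := xstar) (k := k) hgc hr hlaw
    hind hv rfl xstar).trans (measure_mono fun ω hω => ?_)
  rw [Set.mem_ofPred_eq] at hω ⊢
  refine le_trans ?_ hω
  gcongr
  exact le_stepSize_of_nonpos hα hK hξ.le k

/-- If the step sizes are summable, a single random kick is not forgotten. -/
theorem not_allRunsConverge_of_one_lt (hd : 0 < d) (hg : LipschitzWith L (gradient f))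
    (hgrad : gradient f xstar = 0) (hp : 1 < p) (hA : 0 < A) (hB : 0 ≤ B) (hα : 0 < α)
    (hK : 0 < K) (hξ : 1 < ξ) : ¬ AllRunsConverge.{u} f (stepSize α K ξ) p A B xstar := by
  intro hall
  have hp0 : 0 < p := by linarith
  obtain ⟨v, hv⟩ := exists_norm_eq_one hd
  set β : ℝ := A ^ p⁻¹ with hβ
  have hβ0 : 0 < β := by positivity
  have hβp : β ^ p = A := Real.rpow_inv_rpow hA.le hp0.ne'
  set a := stepSize α K ξ with ha
  have hapos : ∀ k, 0 < a k := stepSize_pos hα hK ξ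
  have hasum : Summable a := (summable_stepSize_iff hα hK ξ).2 hξ
  -- The only kick is `w N`, felt first by `x (N + 1)`; the steps from `N + 1` on can undo at most
  -- half of the displacement.
  obtain ⟨N, hN⟩ : ∃ N, (∑' j, a (j + (N + 1))) * L ≤ 1 / 2 := by
    have h1 : Tendsto (fun N => (∑' j, a (j + N)) * L) atTop (𝓝 0) := by
      simpa using (tendsto_sum_nat_add a).mul_const (L : ℝ)
    obtain ⟨M, hM⟩ := eventually_atTop.1 (h1.eventually_le_const (show (0 : ℝ) < 1 / 2 by norm_num))
    exact ⟨M, hM _ M.le_succ⟩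
  obtain ⟨Ω, mΩ, P, r, hP, hr, hlaw, hind⟩ := exists_iIndepFun_symmetricLaw.{u}
    (fun k => if k = N then β else 0) (fun _ => 1) (fun _ => zero_le_one) fun _ => le_rfl
  have hgc := hg.continuous
  have hsgd := isSGD_sgdIterates (a := a) (x₀ := xstar) (v := v) hgc hr
  set x := sgdIterates f a xstar v r with hx
  have hzero : ∀ᵐ ω ∂P, ∀ k, N < k → r k ω = 0 := by
    rw [ae_all_iff]
    intro k
    by_cases hk : N < k
    · have h1 : ∀ᵐ t ∂P.map (r k), t = 0 := by
        rw [hlaw, if_neg hk.ne', symmetricLaw, neg_zero, ae_iff]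
        simp
      filter_upwards [ae_of_ae_map (hr k).aemeasurable h1] with ω hω _ using hω
    · exact ae_of_all _ fun ω h => absurd h hk
  have hpart : ∀ m, (∑ j ∈ Finset.range m, a (j + (N + 1))) * L ≤ 1 / 2 := by
    intro m
    refine le_trans ?_ hN
    gcongr
    exact ((summable_nat_add_iff (N + 1)).2 hasum).sum_le_tsum _ fun j _ => (hapos _).le
  have hkeep : ∀ᵐ ω ∂P, ∀ m, (1 - (∑ j ∈ Finset.range m, a (j + (N + 1))) * L) *
      ‖x (N + 1) ω - xstar‖ ≤ ‖x (m + (N + 1)) ω - xstar‖ := by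
    filter_upwards [hzero] with ω hω m
    induction m with
    | zero => simp
    | succ m ih =>
      have e : x (m + 1 + (N + 1)) ω =
          x (m + (N + 1)) ω - a (m + (N + 1)) • gradient f (x (m + (N + 1)) ω) := by
        rw [show m + 1 + (N + 1) = m + (N + 1) + 1 by ring, hsgd.step, hω _ (by omega)]
        simp [sub_eq_add_neg]
      have h1 := mul_norm_le_norm_step hg hgrad (hapos (m + (N + 1))).le (x (m + (N + 1)) ω)
      rw [e]
      refine le_trans ?_ h1
      have h2 := hpart m
      have h3 := hpart (m + 1)
      rw [Finset.sum_range_succ, add_mul] at h3 ⊢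
      set s := (∑ j ∈ Finset.range m, a (j + (N + 1))) * L
      set t := a (m + (N + 1)) * L
      have hs : 0 ≤ s := mul_nonneg (Finset.sum_nonneg fun j _ => (hapos _).le) L.coe_nonneg
      have ht : 0 ≤ t := mul_nonneg (hapos _).le L.coe_nonneg
      -- Bernoulli's inequality for the product of the factors `1 - a j * L`.
      calc (1 - (s + t)) * ‖x (N + 1) ω - xstar‖
          ≤ ((1 - t) * (1 - s)) * ‖x (N + 1) ω - xstar‖ := by
            gcongr
            nlinarith
        _ = (1 - t) * ((1 - s) * ‖x (N + 1) ω - xstar‖) := by ring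
        _ ≤ _ := by
          gcongr
          linarith
  refine not_ae_tendsto_of_half_le_measure (P := P) (N := N + 1) (ε := a N * β / 2)
    hsgd.measurable_iterate (by have := hapos N; positivity) (fun k hk => ?_)
    (hall Ω P _ _ hsgd (isUnbiasedNoise_sgdIterates hgc hr hlaw hind)
      (hasMomentBound_sgdIterates hgc hr hlaw hind hv hp0 hB (fun _ => zero_le_one)
        (fun k => ?_) xstar))
  · obtain ⟨m, rfl⟩ := Nat.exists_eq_add_of_le' hk
    refine (half_le_measure_le_norm_sub (a := a) (x₀ := xstar) (k := N) hgc hr hlaw hind hv rfl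
      xstar).trans (measure_mono_ae ?_)
    filter_upwards [hkeep] with ω hω h
    have h1 : a N * β ≤ ‖x (N + 1) ω - xstar‖ := by
      have : a N * (if N = N then β else 0) ≤ ‖x (N + 1) ω - xstar‖ := h
      rwa [if_pos rfl] at this
    refine le_trans ?_ (hω m)
    have h2 := hpart m
    calc a N * β / 2 = 1 / 2 * (a N * β) := by ring
      _ ≤ (1 - (∑ j ∈ Finset.range m, a (j + (N + 1))) * L) * ‖x (N + 1) ω - xstar‖ := by
        have := hapos N
        exact mul_le_mul (by linarith) h1 (by positivity) (by linarith)
  · split_ifs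
    · rw [abs_of_pos hβ0, hβp, one_mul]
    · rw [abs_zero, Real.zero_rpow hp0.ne', mul_zero]
      exact hA.le

/-- If the `p`-th powers of bounded step sizes are not summable, rare large noise moves the
iterates by a unit distance infinitely often. -/
theorem not_allRunsConverge_of_le_inv (hd : 0 < d) (hg : LipschitzWith L (gradient f))
    (hgrad : gradient f xstar = 0) (hp : 1 < p) (hA : 0 < A) (hB : 0 ≤ B) (hα : 0 < α)
    (hK : 0 < K) (hξ0 : 0 ≤ ξ) (hξ : ξ ≤ 1 / p) :
    ¬ AllRunsConverge.{u} f (stepSize α K ξ) p A B xstar := by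
  intro hall
  have hp0 : 0 < p := by linarith
  obtain ⟨v, hv⟩ := exists_norm_eq_one hd
  set a := stepSize α K ξ with ha
  have hapos : ∀ k, 0 < a k := stepSize_pos hα hK ξ
  have hapsum : ¬ Summable fun k => a k ^ p := by
    rw [ha, summable_stepSize_rpow_iff hα hK, not_lt]
    exact (le_div_iff₀ hp0).1 hξ
  -- Noise of size `(a k)⁻¹` displaces the iterate by exactly one; this `q k` is the largest
  -- probability the moment bound `A` permits.
  set q : ℕ → ℝ := fun k => min 1 (A * a k ^ p) with hq
  have hq0 : ∀ k, 0 ≤ q k := fun k => by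
    have := hapos k
    simp only [hq]
    positivity
  have hqsum : ¬ Summable q := by
    intro hs
    apply hapsum
    -- If `q` were summable, it would eventually be below one, where it equals `A * a k ^ p`.
    rw [← summable_mul_left_iff hA.ne']
    refine (summable_congr_cofinite ?_).1 hs
    rw [Nat.cofinite_eq_atTop]
    filter_upwards [hs.tendsto_atTop_zero.eventually_lt_const zero_lt_one] with k hk
    simp only [hq, min_lt_iff, lt_irrefl, false_or] at hk ⊢
    exact min_eq_right hk.le
  obtain ⟨Ω, mΩ, P, r, hP, hr, hlaw, hind⟩ := exists_iIndepFun_symmetricLaw.{u}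
    (fun k => (a k)⁻¹) q hq0 fun k => min_le_left _ _
  have hgc := hg.continuous
  have hsgd := isSGD_sgdIterates (a := a) (x₀ := xstar) (v := v) hgc hr
  have hlim := hall Ω P _ _ hsgd (isUnbiasedNoise_sgdIterates hgc hr hlaw hind)
    (hasMomentBound_sgdIterates hgc hr hlaw hind hv hp0 hB hq0 (fun k => by
      have h := hapos k
      rw [abs_of_pos (inv_pos.2 h), Real.inv_rpow h.le]
      calc q k * (a k ^ p)⁻¹ ≤ A * a k ^ p * (a k ^ p)⁻¹ := by
            gcongr
            exact min_le_right _ _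
        _ = A := by field_simp) xstar)
  set x := sgdIterates f a xstar v r with hx
  set T : ℕ → Set ℝ := fun k => {(a k)⁻¹, -(a k)⁻¹} with hT
  have hTm : ∀ k, MeasurableSet (T k) := fun k => (Set.toFinite _).measurableSet
  have hTq : ∀ k, ENNReal.ofReal (q k) ≤ P (r k ⁻¹' T k) := by
    intro k
    rw [← Measure.map_apply (hr k) (hTm k), ← lintegral_indicator_one (hTm k), hlaw,
      lintegral_symmetricLaw, Set.indicator_of_mem (by simp [hT]), Set.indicator_of_mem (by simp [hT])]
    simp only [Pi.one_apply, mul_one]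
    rw [ofReal_half_add_half (hq0 k)]
    exact le_self_add
  have hio : P (limsup (fun k => r k ⁻¹' T k) atTop) = 1 := by
    refine measure_limsup_eq_one (fun k => hr k (hTm k)) ?_ ?_
    · rw [iIndepSet_iff_meas_biInter fun k => hr k (hTm k)]
      exact fun s => hind.meas_biInter fun i _ => ⟨T i, hTm i, rfl⟩
    · refine top_unique (le_trans ?_ (ENNReal.tsum_le_tsum hTq))
      rw [top_le_iff]
      by_contra hne
      refine hqsum ((ENNReal.summable_toReal hne).congr fun k => ?_)
      rw [ENNReal.toReal_ofReal (hq0 k)]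
  have hio' : ∀ᵐ ω ∂P, ω ∈ limsup (fun k => r k ⁻¹' T k) atTop :=
    (mem_ae_iff_prob_eq_one (MeasurableSet.measurableSet_limsup fun k => hr k (hTm k))).2 hio
  obtain ⟨ω, hω, hfreq⟩ := (hlim.and hio').exists
  rw [mem_limsup_iff_frequently_mem] at hfreq
  -- Along a convergent path both the increments and the gradient steps vanish, so the noise
  -- displacement `a k • r k ω • v` must too, although its norm is one infinitely often.
  have h1 : Tendsto (fun k => x (k + 1) ω - x k ω) atTop (𝓝 0) := by
    simpa using ((tendsto_add_atTop_iff_nat 1).2 hω).sub hω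
  have h2 : Tendsto (fun k => a k • gradient f (x k ω)) atTop (𝓝 0) := by
    have h3 : Tendsto (fun k => gradient f (x k ω)) atTop (𝓝 0) := by
      rw [← hgrad]
      exact (hgc.tendsto xstar).comp hω
    refine squeeze_zero_norm (fun k => ?_) (by simpa using h3.norm.const_mul (α * K ^ (-ξ)))
    rw [norm_smul, Real.norm_eq_abs, abs_of_pos (hapos k)]
    gcongr
    exact stepSize_le_of_nonneg hα hK hξ0 k
  have h4 : Tendsto (fun k => ‖a k • r k ω • v‖) atTop (𝓝 0) := by
    have h5 := (h1.add h2).norm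
    rw [add_zero, norm_zero] at h5
    refine h5.congr fun k => ?_
    congr 1
    rw [hsgd.step, smul_add, smul_neg]
    abel
  obtain ⟨k, hk, hk1⟩ := (hfreq.and_eventually (h4.eventually_lt_const zero_lt_one)).exists
  rw [norm_smul, norm_smul, hv, mul_one, Real.norm_eq_abs, abs_of_pos (hapos k)] at hk1
  have h6 : ‖r k ω‖ = (a k)⁻¹ := by
    have h7 := (inv_pos.2 (hapos k)).le
    rcases hk with h | h
    · rw [h, Real.norm_eq_abs, abs_of_nonneg h7]
    · rw [Set.mem_singleton_iff.1 h, norm_neg, Real.norm_eq_abs, abs_of_nonneg h7]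
  rw [h6, mul_inv_cancel₀ (hapos k).ne'] at hk1
  exact lt_irrefl _ hk1

end Necessity

theorem mainTheorem8 {d : ℕ} (hd : 0 < d) (f : EuclideanSpace ℝ (Fin d) → ℝ) (L : ℝ≥0)
    (hsmooth : IsSmoothWith L f) (fstar : ℝ) (hPL : SatisfiesPL f fstar)
    (xstar : EuclideanSpace ℝ (Fin d)) (hxstar : ∀ x, gradient f x = 0 ↔ x = xstar)
    (p : ℝ) (hp : 1 < p) (A B : ℝ) (hA : 0 < A) (hB : 0 ≤ B)
    (α K : ℝ) (hα : 0 < α) (hK : 0 < K) (ξ : ℝ) :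
    IsLyapunovFunction (fun x => x - gradient f x) xstar (fun z => f (xstar + z) - fstar) ∧
    ((∀ (Ω : Type u) [MeasurableSpace Ω] (P : Measure Ω) [IsProbabilityMeasure P]
        (x w : ℕ → Ω → EuclideanSpace ℝ (Fin d)),
        IsSGD f (stepSize α K ξ) x w → IsUnbiasedNoise P x w →
        HasMomentBound P p A B xstar x w →
        ∀ᵐ ω ∂P, Tendsto (fun k => x k ω) atTop (𝓝 xstar)) ↔
      ξ ∈ Set.Ioc (1 / p) 1) := by
  have hgrad : gradient f xstar = 0 := (hxstar xstar).2 rfl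
  refine ⟨isLyapunovFunction_of_isSmoothWith hsmooth hPL hxstar, fun hall => ?_, ?_⟩
  · change AllRunsConverge.{u} f (stepSize α K ξ) p A B xstar at hall
    by_contra hξ
    rw [Set.mem_Ioc, not_and_or, not_lt, not_le] at hξ
    rcases hξ with hξ | hξ
    -- Negative `ξ` is treated apart: the steps are then unbounded, and the unit-jump argument needs
    -- bounded steps to make the gradient steps vanish.
    · rcases lt_or_ge ξ 0 with h0 | h0
      · exact not_allRunsConverge_of_neg hd hsmooth.2 hp hA hB hα hK h0 hall
      · exact not_allRunsConverge_of_le_inv hd hsmooth.2 hgrad hp hA hB hα hK h0 hξ hall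
    · exact not_allRunsConverge_of_one_lt hd hsmooth.2 hgrad hp hA hB hα hK hξ hall
  · intro hξ Ω _ P _ x w hsgd hunb hmom
    exact ae_tendsto_of_isSGD hsmooth hPL hxstar hp hA.le hB hα hK hξ hsgd hunb hmom
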